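/- **Setting.** Let $\Theta$ and $\mathsf Z$ be measurable spaces with $\sigma$-finite reference measures $\mathrm d\theta$, $\mathrm dz$, and let $T\ge 1$, $M\ge1$, $N\ge1$ be integers. Consider a state-space model with initial density $\mu_\theta(z_1)$, transition density $f_\theta(z,z')$ and observation density $g_\theta(z,y)$, fixed observations $y=y_{1:T}$, and $$p_\theta(z,y)=\mu_\theta(z_1)\prod_{t=2}^{T}f_\theta(z_{t-1},z_t)\prod_{t=1}^{T}g_\theta(z_t,y_t),\qquad z=z_{1:T}\in\mathsf Z^T .$$ Let $\eta$ be a prior density and $q(\theta,\theta')$ a proposal density on $\Theta$, and let $\pi(\mathrm d(\theta,z))\propto\eta(\theta)p_\theta(z,y)\,\mathrm d\theta\,\mathrm dz$ be the posterior, whose normalising constant is assumed to lie in $(0,\infty)$. Let $\tilde\theta_1,\tilde\theta_2:\Theta^2\to\Theta$ be measurable with $\tilde\theta_1(\theta,\theta')=\tilde\theta_2(\theta',\theta)$. $\mathcal P(w_1,\dots,w_m)$ denotes the law on $\{1,\dots,m\}$ proportional to the weights $w_i\ge 0$ (uniform if they cannot be normalised). *Conditional SMC.* Particles are initialised from a density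 $h_\theta$, positive wherever $\mu_\theta$ is, and propagated with a transition density $H_\theta$ such that $f_\theta(z,z')=H_\theta(z,z')\rho_\theta(z')$ for some $\rho_\theta\ge0$. Thus the weights $w_1(a)=\mu_\theta(a)g_\theta(a,y_1)/h_\theta(a)$ and $w_t(a)=\rho_\theta(a)g_\theta(a,y_t)$, $t\ge2$, depend only on the current particle; the bootstrap choice $h=\mu$, $H=f$, $\rho=1$ is included. $\mathrm{cSMC}(M,\theta,z)$ produces $\zeta=(\zeta_t^{(i)})_{t\le T,\,i\le M}$: set $\zeta_t^{(1)}=z_t$ for all $t$; for $i=2,\dots,M$ draw $\zeta_1^{(i)}\sim h_\theta$ independently and, for $t\ge2$, draw independently $a^{(i)}_{t-1}\sim\mathcal P(w_{t-1}(\zeta_{t-1}^{(1)}),\dots,w_{t-1}(\zeta_{t-1}^{(M)}))$ and $\zeta_t^{(i)}\sim H_\theta(\zeta_{t-1}^{(a^{(i)}_{t-1})},\cdot)$. Backward sampling $\check\Phi_\theta(\zeta,\cdot)$ draws $k_T\sim\mathcal P\big((w_T(\zeta_T^{(i)}))_i\big)$, then for $t=T-1,\dots,1$ draws $k_t\sim\mathcal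 P\big((w_t(\zeta_t^{(i)})f_\theta(\zeta_t^{(i)},\zeta_{t+1}^{(k_{t+1})}))_i\big)$, and returns the path $(\zeta_1^{(k_1)},\dots,\zeta_T^{(k_T)})$. *Ratios.* For $\theta,\theta',\tilde\theta\in\Theta$, $z,u\in\mathsf Z^T$ and $\mathfrak u=(u^{(1)},\dots,u^{(N)})$, put $$\mathring r_{z,u}(\theta,\theta';\tilde\theta)=\frac{q(\theta',\theta)\eta(\theta')p_{\theta'}(u,y)p_{\tilde\theta}(z,y)}{q(\theta,\theta')\eta(\theta)p_{\tilde\theta}(u,y)p_\theta(z,y)}\in[0,\infty],\qquad \mathring r^N_{z,\mathfrak u}=\frac1N\sum_{i=1}^N\mathring r_{z,u^{(i)}},$$ where a ratio is $0$ if its numerator is $0$ and $\infty$ if only its denominator is $0$. *Algorithm.* From $(\theta,z)$, draw $\theta'\sim q(\theta,\cdot)$ and, with probability $1/2$ each, do one of the following. 1. Set $\tilde\theta=\tilde\theta_1(\theta,\theta')$. Run $\mathrm{cSMC}(M,\tilde\theta,z)$ to get $\zeta$, draw $u^{(1)},\dots,u^{(N)}$ i.i.d. from $\check\Phi_{\tilde\theta}(\zeta,\cdot)$,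 draw $k\sim\mathcal P\big((\mathring r_{z,u^{(i)}}(\theta,\theta';\tilde\theta))_{i\le N}\big)$ and set $z'=u^{(k)}$. Move to $(\theta',z')$ with probability $\min\{1,\mathring r^N_{z,\mathfrak u}(\theta,\theta';\tilde\theta)\}$; otherwise stay at $(\theta,z)$. 2. Set $\tilde\theta=\tilde\theta_2(\theta,\theta')$. Draw $k$ uniformly from $\{1,\dots,N\}$, set $u^{(k)}=z$, run $\mathrm{cSMC}(M,\tilde\theta,z)$ to get $\zeta$, and draw $u^{(1)},\dots,u^{(k-1)},z',u^{(k+1)},\dots,u^{(N)}$ i.i.d. from $\check\Phi_{\tilde\theta}(\zeta,\cdot)$. Move to $(\theta',z')$ with probability $\min\{1,1/\mathring r^N_{z',\mathfrak u}(\theta',\theta;\tilde\theta)\}$ (with probability $0$ if $p_{\tilde\theta}(z,y)=0$, when cSMC with reference path $z$ is not defined); otherwise stay at $(\theta,z)$. **Theorem.** The law of the next state is a Markov transition kernel $P$ on $\Theta\times\mathsf Z^T$, $\pi$ is a probability measure, and $P$ satisfies detailed balance with respect to $\pi$: for all measurable $A,B\subseteq\Theta\times\mathsf Z^T$, $$\int_A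 P(x,B)\,\pi(\mathrm dx)=\int_B P(x,A)\,\pi(\mathrm dx).$$ -/

import Mathlib

open MeasureTheory ProbabilityTheory
open scoped ENNReal NNReal

noncomputable section

namespace MHAAR

/-- Latent trajectories `z = z_{1:T}`, where `T = n + 1`. -/
abbrev Path (Z : Type*) (n : ℕ) := Fin (n + 1) → Z

/-- Particle systems `ζ = (ζ_t^{(i)})`, with `T = n + 1` times and `M` particles. -/
abbrev Swarm (Z : Type*) (n M : ℕ) := Fin (n + 1) → Fin M → Z

/-- Index vectors `𝐤 = (k_1, …, k_T)`. -/
abbrev Lineage (n M : ℕ) := Fin (n + 1) → Fin M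

/-- The probability vector `𝒫(w_1, …, w_m)`, proportional to the weights. When the weights cannot
be normalised (total `0` or `∞`) it is taken to be uniform. -/
def choice {ι : Type*} [Fintype ι] (w : ι → ℝ≥0∞) (k : ι) : ℝ≥0∞ :=
  if ∑ i, w i = 0 ∨ ∑ i, w i = ∞ then (Fintype.card ι : ℝ≥0∞)⁻¹ else w k / ∑ i, w i

/-- A state-space model with parameter `θ`, its observations `y_{1:T}` (`T = n + 1`), a prior
density `η` and a proposal density `q` for the parameter, the proposal densities `h`, `H` of the
particles, and the functions selecting the intermediate parameter. Densities on `Θ` are with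
respect to `σ`, densities on `Z` are with respect to `lam`. -/
structure Setting (Θ Z Y : Type*) [MeasurableSpace Θ] [MeasurableSpace Z]
    (σ : Measure Θ) (lam : Measure Z) (n : ℕ) where
  /-- initial density `μ_θ(z₁)` -/
  μ : Θ → Z → ℝ≥0
  /-- transition density `f_θ(z, z')` -/
  f : Θ → Z → Z → ℝ≥0
  /-- observation density `g_θ(z, y)` -/
  g : Θ → Z → Y → ℝ≥0
  /-- the observations -/
  y : Fin (n + 1) → Y
  /-- prior density `η(θ)` -/
  η : Θ → ℝ≥0
  /-- parameter proposal density `q(θ, θ')` -/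
  q : Θ → Θ → ℝ≥0
  /-- initial particle density `h_θ(z₁)` -/
  h : Θ → Z → ℝ≥0
  /-- particle propagation density `H_θ(z, z')` -/
  H : Θ → Z → Z → ℝ≥0
  /-- the ratio `f_θ(z, z') / H_θ(z, z')`, a function of `θ` and `z'` -/
  ρ : Θ → Z → ℝ≥0
  /-- intermediate parameters `θ̃₁`, `θ̃₂` -/
  mid₁ : Θ → Θ → Θ
  mid₂ : Θ → Θ → Θ
  measurable_μ : Measurable fun p : Θ × Z => μ p.1 p.2
  measurable_f : Measurable fun p : Θ × Z × Z => f p.1 p.2.1 p.2.2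
  measurable_g : ∀ t, Measurable fun p : Θ × Z => g p.1 p.2 (y t)
  measurable_η : Measurable η
  measurable_q : Measurable fun p : Θ × Θ => q p.1 p.2
  measurable_h : Measurable fun p : Θ × Z => h p.1 p.2
  measurable_H : Measurable fun p : Θ × Z × Z => H p.1 p.2.1 p.2.2
  measurable_ρ : Measurable fun p : Θ × Z => ρ p.1 p.2
  measurable_mid₁ : Measurable fun p : Θ × Θ => mid₁ p.1 p.2
  measurable_mid₂ : Measurable fun p : Θ × Θ => mid₂ p.1 p.2
  lintegral_μ : ∀ θ, ∫⁻ z, μ θ z ∂lam = 1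
  lintegral_f : ∀ θ z, ∫⁻ z', f θ z z' ∂lam = 1
  lintegral_q : ∀ θ, ∫⁻ θ', q θ θ' ∂σ = 1
  lintegral_h : ∀ θ, ∫⁻ z, h θ z ∂lam = 1
  lintegral_H : ∀ θ z, ∫⁻ z', H θ z z' ∂lam = 1
  /-- the initial particle density dominates the initial density of the model -/
  h_ne_zero : ∀ θ z, μ θ z ≠ 0 → h θ z ≠ 0
  /-- the weights do not depend on the ancestor; the bootstrap choice is `h = μ`, `H = f`,
  `ρ = 1` -/
  f_eq : ∀ θ z z', f θ z z' = H θ z z' * ρ θ z'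
  mid_symm : ∀ θ θ', mid₁ θ θ' = mid₂ θ' θ

/-- The kernel `a ↦ ∑ i, p i a • δ_{F i a}`. -/
def discreteKernel {ι α β : Type*} [Fintype ι] [MeasurableSpace α] [MeasurableSpace β]
    (p : ι → α → ℝ≥0∞) (F : ι → α → β) (hp : ∀ i, Measurable (p i))
    (hF : ∀ i, Measurable (F i)) : Kernel α β where
  toFun a := ∑ i, p i a • Measure.dirac (F i a)
  measurable' := by
    refine Measure.measurable_of_measurable_coe _ fun s hs => ?_
    simp only [Measure.coe_finsetSum, Finset.sum_apply, Measure.smul_apply, smul_eq_mul,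
      Measure.dirac_apply' _ hs]
    exact Finset.measurable_sum _ fun i _ =>
      (hp i).mul ((measurable_one.indicator hs).comp (hF i))

/-- The equal-weight mixture of two kernels. -/
def halfMix {α β : Type*} [MeasurableSpace α] [MeasurableSpace β] (κ κ' : Kernel α β) :
    Kernel α β where
  toFun a := (2⁻¹ : ℝ≥0∞) • κ a + (2⁻¹ : ℝ≥0∞) • κ' a
  measurable' := by
    refine Measure.measurable_of_measurable_coe _ fun s hs => ?_
    simp only [Measure.add_apply, Measure.smul_apply, smul_eq_mul]
    exact ((κ.measurable_coe hs).const_mul _).add ((κ'.measurable_coe hs).const_mul _)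

theorem measurable_choice {ι α : Type*} [Fintype ι] [MeasurableSpace α] {w : α → ι → ℝ≥0∞}
    (hw : ∀ i, Measurable fun a => w a i) (k : ι) : Measurable fun a => choice (w a) k := by
  have hs : Measurable fun a => ∑ i, w a i := Finset.measurable_sum _ fun i _ => hw i
  unfold choice
  exact Measurable.ite ((hs (measurableSet_singleton 0)).union (hs (measurableSet_singleton ∞)))
    measurable_const ((hw k).div hs)

/-- The particle system whose particle `0` is the reference path `z` at each time, the others
being those listed in `v`. -/
def insertPath {Z : Type*} {n M : ℕ} [NeZero M] (z : Path Z n)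
    (v : Fin (n + 1) → {i : Fin M // i ≠ 0} → Z) : Swarm Z n M :=
  fun t i => if hi : i = 0 then z t else v t ⟨i, hi⟩

theorem measurable_insertPath {Z : Type*} [MeasurableSpace Z] {n M : ℕ} [NeZero M] :
    Measurable fun p : Path Z n × (Fin (n + 1) → {i : Fin M // i ≠ 0} → Z) =>
      insertPath p.1 p.2 := by
  refine measurable_pi_lambda _ fun t => measurable_pi_lambda _ fun i => ?_
  by_cases hi : i = 0
  · simp only [insertPath, hi, dite_true]; fun_prop
  · simp only [insertPath, hi, dite_false]; fun_prop

namespace Setting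

variable {Θ Z Y : Type*} [MeasurableSpace Θ] [MeasurableSpace Z] {σ : Measure Θ}
  {lam : Measure Z} {n : ℕ} (S : Setting Θ Z Y σ lam n)

/-- The joint density `p_θ(z_{1:T}, y_{1:T})` at the observations. -/
def joint (θ : Θ) (z : Path Z n) : ℝ≥0 :=
  S.μ θ (z 0) * (∏ t : Fin n, S.f θ (z t.castSucc) (z t.succ)) *
    ∏ t : Fin (n + 1), S.g θ (z t) (S.y t)

/-- The normalising constant `∫ η(θ) p_θ(z, y) dθ dz` of the posterior. -/
def evidence : ℝ≥0∞ :=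
  ∫⁻ x : Θ × Path Z n, S.η x.1 * S.joint x.1 x.2 ∂(σ.prod (Measure.pi fun _ => lam))

/-- The posterior `π(d(θ, z))`, with density proportional to `η(θ) p_θ(z, y)`. -/
def posterior : Measure (Θ × Path Z n) :=
  (S.evidence)⁻¹ • (σ.prod (Measure.pi fun _ => lam)).withDensity
    fun x => S.η x.1 * S.joint x.1 x.2

/-- The particle weights: `w_1 = μ g / h` and `w_t = f g / H = ρ g` for `t > 1`. -/
def weight (θ : Θ) (t : Fin (n + 1)) (a : Z) : ℝ≥0∞ :=
  if t = 0 then ((S.μ θ a * S.g θ a (S.y t) / S.h θ a : ℝ≥0) : ℝ≥0∞)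
  else ((S.ρ θ a * S.g θ a (S.y t) : ℝ≥0) : ℝ≥0∞)

/-- The density of the particles with a label other than `0` in the conditional SMC algorithm at
`θ`: they are drawn from `h_θ` at the first time, and later independently from the mixture
`∑ j, W_{t-1}^{(j)} H_θ(ζ_{t-1}^{(j)}, ·)`, which is the law of `ζ_t^{(i)}` when its ancestor is
drawn from `𝒫(w_{t-1}^{(1)}, …, w_{t-1}^{(M)})`. -/
def cSMCDensity {M : ℕ} [NeZero M] (θ : Θ) (ζ : Swarm Z n M) : ℝ≥0∞ :=
  (∏ i : {i : Fin M // i ≠ 0}, (S.h θ (ζ 0 i) : ℝ≥0∞)) *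
    ∏ t : Fin n, ∏ i : {i : Fin M // i ≠ 0}, ∑ j : Fin M,
      choice (fun l => S.weight θ t.castSucc (ζ t.castSucc l)) j *
        (S.H θ (ζ t.castSucc j) (ζ t.succ i) : ℝ≥0∞)

/-- The law of the particles `ζ` generated by `cSMC(M, θ, z)`, as a kernel in `(θ, z)`. -/
def cSMC [SigmaFinite lam] (M : ℕ) [NeZero M] : Kernel (Θ × Path Z n) (Swarm Z n M) :=
  (Kernel.id ×ₖ
    Kernel.withDensity
      (Kernel.const (Θ × Path Z n)
        (Measure.pi fun _ : Fin (n + 1) => Measure.pi fun _ : {i : Fin M // i ≠ 0} => lam))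
      (fun x v => S.cSMCDensity x.1 (insertPath x.2 v))).map
    fun p => insertPath p.1.2 p.2

/-- The backward-sampling probability `φ_θ(𝐤 | ζ)`. -/
def backwardProb {M : ℕ} (θ : Θ) (ζ : Swarm Z n M) (k : Lineage n M) : ℝ≥0∞ :=
  choice (fun i => S.weight θ (Fin.last n) (ζ (Fin.last n) i)) (k (Fin.last n)) *
    ∏ t : Fin n, choice (fun i => S.weight θ t.castSucc (ζ t.castSucc i) *
      (S.f θ (ζ t.castSucc i) (ζ t.succ (k t.succ)) : ℝ≥0∞)) (k t.castSucc)

theorem measurable_weight (t : Fin (n + 1)) : Measurable fun p : Θ × Z => S.weight p.1 t p.2 := by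
  unfold weight
  split_ifs
  · exact ((S.measurable_μ.mul (S.measurable_g t)).div S.measurable_h).coe_nnreal_ennreal
  · exact (S.measurable_ρ.mul (S.measurable_g t)).coe_nnreal_ennreal

theorem measurable_backwardProb {M : ℕ} (k : Lineage n M) :
    Measurable fun p : Θ × Swarm Z n M => S.backwardProb p.1 p.2 k := by
  have hw (t : Fin (n + 1)) (i : Fin M) :
      Measurable fun p : Θ × Swarm Z n M => S.weight p.1 t (p.2 t i) :=
    (S.measurable_weight t).comp (g := fun p : Θ × Z => S.weight p.1 t p.2)
      (f := fun p : Θ × Swarm Z n M => (p.1, p.2 t i)) (by fun_prop)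
  refine (measurable_choice (fun i => hw _ i) _).mul (Finset.measurable_prod _ fun t _ => ?_)
  refine measurable_choice (fun i => (hw _ i).mul ?_) _
  exact (S.measurable_f.comp (f := fun p : Θ × Swarm Z n M =>
    (p.1, p.2 t.castSucc i, p.2 t.succ (k t.succ))) (by fun_prop)).coe_nnreal_ennreal

/-- `N` independent paths `u^{(1)}, …, u^{(N)}` drawn by backward sampling given `(θ, ζ)`. -/
def backwardPaths (N M : ℕ) : Kernel (Θ × Swarm Z n M) (Fin N → Path Z n) :=
  discreteKernel (ι := Fin N → Lineage n M)
    (fun K p => ∏ i, S.backwardProb p.1 p.2 (K i))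
    (fun K p i t => p.2 t (K i t))
    (fun K => Finset.measurable_prod _ fun i _ => S.measurable_backwardProb (K i))
    (fun K => by fun_prop)

/-- Run `cSMC(M, θ, z)` and draw `N` paths by backward sampling from its particles. -/
def cSMCPaths [SigmaFinite lam] (N M : ℕ) [NeZero M] :
    Kernel (Θ × Path Z n) (Fin N → Path Z n) :=
  S.backwardPaths N M ∘ₖ (Kernel.deterministic Prod.fst measurable_fst ×ₖ S.cSMC M)

/-- The proposal `θ' ∼ q(θ, ·)`. -/
def propose [SFinite σ] : Kernel Θ Θ :=
  Kernel.withDensity (Kernel.const Θ σ) fun θ θ' => (S.q θ θ' : ℝ≥0∞)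

/-- From `x = (θ, z)`, draw `θ' ∼ q(θ, ·)` and then `N` backward-sampled paths from one run of
`cSMC(M, θ̃, z)`, where `θ̃ = mid θ θ'`. -/
def draw [SFinite σ] [SigmaFinite lam] (N M : ℕ) [NeZero M] (mid : Θ → Θ → Θ)
    (hmid : Measurable fun p : Θ × Θ => mid p.1 p.2) :
    Kernel (Θ × Path Z n) (Θ × (Fin N → Path Z n)) :=
  (S.propose.comap Prod.fst measurable_fst) ⊗ₖ
    ((S.cSMCPaths N M).comap
      (fun p : (Θ × Path Z n) × Θ => (mid p.1.1 p.2, p.1.2))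
      ((hmid.comp (f := fun p : (Θ × Path Z n) × Θ => (p.1.1, p.2)) (by fun_prop)).prodMk
        (by fun_prop)))

/-- The ratio `r̊_{z,u}(θ, θ'; θ̃)`, in `[0, ∞]`: it is `0` when its numerator is `0`, and `∞` when
only its denominator is `0`. -/
def ratio (θ θ' θm : Θ) (z u : Path Z n) : ℝ≥0∞ :=
  ((S.q θ' θ * S.η θ' * S.joint θ' u * S.joint θm z : ℝ≥0) : ℝ≥0∞) /
    ((S.q θ θ' * S.η θ * S.joint θm u * S.joint θ z : ℝ≥0) : ℝ≥0∞)

/-- The averaged ratio `r̊^N_{z,𝔲}(θ, θ'; θ̃)`. -/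
def avgRatio {N : ℕ} (θ θ' θm : Θ) (z : Path Z n) (u : Fin N → Path Z n) : ℝ≥0∞ :=
  (N : ℝ≥0∞)⁻¹ * ∑ i, S.ratio θ θ' θm z (u i)

/-- Acceptance probability in the first branch. -/
def accept₁ {N : ℕ} (θ θ' : Θ) (z : Path Z n) (u : Fin N → Path Z n) : ℝ≥0∞ :=
  min 1 (S.avgRatio θ θ' (S.mid₁ θ θ') z u)

/-- Acceptance probability in the second branch. A reference path outside the support of
`π_θ̃`, for which the conditional SMC algorithm at `θ̃` is not defined, is never moved. (In the
first branch the ratio vanishes in that case.) -/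
def accept₂ {N : ℕ} (θ θ' : Θ) (z z' : Path Z n) (u : Fin N → Path Z n) : ℝ≥0∞ :=
  if S.joint (S.mid₂ θ θ') z = 0 then 0
  else min 1 (S.avgRatio θ' θ (S.mid₂ θ θ') z' u)⁻¹

theorem measurable_joint : Measurable fun p : Θ × Path Z n => S.joint p.1 p.2 := by
  unfold joint
  refine ((S.measurable_μ.comp (f := fun p : Θ × Path Z n => (p.1, p.2 0)) (by fun_prop)).mul
    (Finset.measurable_prod _ fun t _ => ?_)).mul (Finset.measurable_prod _ fun t _ => ?_)
  · exact S.measurable_f.comp (f := fun p : Θ × Path Z n => (p.1, p.2 t.castSucc, p.2 t.succ))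
      (by fun_prop)
  · exact (S.measurable_g t).comp (f := fun p : Θ × Path Z n => (p.1, p.2 t)) (by fun_prop)

theorem measurable_ratio {α : Type*} [MeasurableSpace α] {a b c : α → Θ} {z u : α → Path Z n}
    (ha : Measurable a) (hb : Measurable b) (hc : Measurable c) (hz : Measurable z)
    (hu : Measurable u) : Measurable fun x => S.ratio (a x) (b x) (c x) (z x) (u x) := by
  have hq {s t : α → Θ} (hs : Measurable s) (ht : Measurable t) :
      Measurable fun x => S.q (s x) (t x) := S.measurable_q.comp (hs.prodMk ht)
  have hj {s : α → Θ} {t : α → Path Z n} (hs : Measurable s) (ht : Measurable t) :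
      Measurable fun x => S.joint (s x) (t x) := S.measurable_joint.comp (hs.prodMk ht)
  exact ((((hq hb ha).mul (S.measurable_η.comp hb)).mul (hj hb hu)).mul
    (hj hc hz)).coe_nnreal_ennreal.div
      ((((hq ha hb).mul (S.measurable_η.comp ha)).mul (hj hc hu)).mul
        (hj ha hz)).coe_nnreal_ennreal

theorem measurable_avgRatio {α : Type*} [MeasurableSpace α] {N : ℕ} {a b c : α → Θ}
    {z : α → Path Z n} {u : α → Fin N → Path Z n}
    (ha : Measurable a) (hb : Measurable b) (hc : Measurable c) (hz : Measurable z)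
    (hu : Measurable u) : Measurable fun x => S.avgRatio (a x) (b x) (c x) (z x) (u x) :=
  (Finset.measurable_sum _ fun i _ =>
    S.measurable_ratio ha hb hc hz ((measurable_pi_apply i).comp hu)).const_mul _

theorem measurable_accept₁ {N : ℕ} :
    Measurable fun p : (Θ × Path Z n) × (Θ × (Fin N → Path Z n)) =>
      S.accept₁ p.1.1 p.2.1 p.1.2 p.2.2 :=
  measurable_const.min (S.measurable_avgRatio (by fun_prop) (by fun_prop)
    (S.measurable_mid₁.comp (f := fun p : (Θ × Path Z n) × (Θ × (Fin N → Path Z n)) =>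
      (p.1.1, p.2.1)) (by fun_prop)) (by fun_prop) (by fun_prop))

theorem measurable_accept₂ {N : ℕ} (k : Fin N) :
    Measurable fun p : (Θ × Path Z n) × (Θ × (Fin N → Path Z n)) =>
      S.accept₂ p.1.1 p.2.1 p.1.2 (p.2.2 k) (Function.update p.2.2 k p.1.2) := by
  have hm := S.measurable_mid₂.comp
    (f := fun p : (Θ × Path Z n) × (Θ × (Fin N → Path Z n)) => (p.1.1, p.2.1)) (by fun_prop)
  unfold accept₂
  refine Measurable.ite ((S.measurable_joint.comp (hm.prodMk (by fun_prop :
    Measurable fun p : (Θ × Path Z n) × (Θ × (Fin N → Path Z n)) => p.1.2)))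
      (measurableSet_singleton 0)) measurable_const ?_
  refine measurable_const.min (S.measurable_avgRatio (by fun_prop) (by fun_prop) hm
    (by fun_prop) ?_).inv
  refine measurable_pi_lambda _ fun i => ?_
  by_cases hi : i = k
  · subst hi; simp only [Function.update_self]; fun_prop
  · simp only [Function.update_of_ne hi]; fun_prop

/-- Selection and acceptance in the first branch, given the current `(θ, z)` and the drawn
`(θ', u^{(1:N)})`: `k ∼ 𝒫(r̊_{z,u^{(1)}}, …, r̊_{z,u^{(N)}})`, `z' = u^{(k)}`, and `(θ', z')` is
accepted (`true`) or rejected (`false`). -/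
def move₁ (N : ℕ) : Kernel ((Θ × Path Z n) × (Θ × (Fin N → Path Z n))) (Θ × Path Z n) :=
  discreteKernel (ι := Fin N × Bool)
    (fun kb p => choice (fun i => S.ratio p.1.1 p.2.1 (S.mid₁ p.1.1 p.2.1) p.1.2 (p.2.2 i)) kb.1 *
      bif kb.2 then S.accept₁ p.1.1 p.2.1 p.1.2 p.2.2
      else 1 - S.accept₁ p.1.1 p.2.1 p.1.2 p.2.2)
    (fun kb p => bif kb.2 then (p.2.1, p.2.2 kb.1) else p.1)
    (by
      rintro ⟨k, b⟩
      refine (measurable_choice (fun i => S.measurable_ratio (by fun_prop) (by fun_prop)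
        (S.measurable_mid₁.comp (f := fun p : (Θ × Path Z n) × (Θ × (Fin N → Path Z n)) =>
          (p.1.1, p.2.1)) (by fun_prop)) (by fun_prop) (by fun_prop)) k).mul ?_
      cases b
      · exact measurable_const.sub S.measurable_accept₁
      · exact S.measurable_accept₁)
    (by
      rintro ⟨k, b⟩
      cases b
      · exact measurable_fst
      · simp only [cond_true]; fun_prop)

/-- Selection and acceptance in the second branch, given the current `(θ, z)` and the drawn
`(θ', v^{(1:N)})`: `k` is uniform, `z' = v^{(k)}`, `u^{(k)} = z` and `u^{(i)} = v^{(i)}` for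
`i ≠ k`, and `(θ', z')` is accepted (`true`) or rejected (`false`). -/
def move₂ (N : ℕ) : Kernel ((Θ × Path Z n) × (Θ × (Fin N → Path Z n))) (Θ × Path Z n) :=
  discreteKernel (ι := Fin N × Bool)
    (fun kb p => (N : ℝ≥0∞)⁻¹ *
      bif kb.2 then S.accept₂ p.1.1 p.2.1 p.1.2 (p.2.2 kb.1) (Function.update p.2.2 kb.1 p.1.2)
      else 1 - S.accept₂ p.1.1 p.2.1 p.1.2 (p.2.2 kb.1) (Function.update p.2.2 kb.1 p.1.2))
    (fun kb p => bif kb.2 then (p.2.1, p.2.2 kb.1) else p.1)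
    (by
      rintro ⟨k, b⟩
      cases b
      · exact (measurable_const.sub (S.measurable_accept₂ k)).const_mul _
      · exact (S.measurable_accept₂ k).const_mul _)
    (by
      rintro ⟨k, b⟩
      cases b
      · exact measurable_fst
      · simp only [cond_true]; fun_prop)

/-- The transition kernel of the algorithm with `M` particles and `N` backward-sampled paths: each
of the two branches is run with probability `1/2`. -/
def transition [SFinite σ] [SigmaFinite lam] (N M : ℕ) [NeZero M] :
    Kernel (Θ × Path Z n) (Θ × Path Z n) :=
  halfMix
    (S.move₁ N ∘ₖ (Kernel.id ×ₖ
      S.draw N M S.mid₁ S.measurable_mid₁))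
    (S.move₂ N ∘ₖ (Kernel.id ×ₖ
      S.draw N M S.mid₂ S.measurable_mid₂))

end Setting

end MHAAR

end

noncomputable section

namespace MHAAR

/-! Fix `θ, θ'` and the intermediate parameter `m`, which by `mid_symm` is the same for branch 1
from `θ` to `θ'` and for branch 2 from `θ'` to `θ`. The claim is that the accepted flow of the one
equals the reversed accepted flow of the other; rejected moves only contribute a diagonal term,
which is always symmetric.

The first ingredient is exchangeability. If the reference path has density `p_m(·, y)`, then the
joint density of reference and particles is that of an unconditional SMC swarm, times the product of
its total weights, times the backward-sampling probability of the reference lineage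
(`joint_mul_cSMCDensity`). The first two factors are invariant under relabelling the particles
separately at each time. Hence the reference lineage may be taken uniform over all lineages, and
given the swarm it then becomes one more independent backward draw. So swapping `z` with any
`u^{(k)}` preserves the joint law of `(z, 𝔲)` (`lintegral_joint_cSMCPaths_swap`).

The second ingredient is algebraic. Relative to that joint law, put `x = η(θ) p_θ(z, y) q(θ, θ') /
p_m(z, y)` and let `y_i` be the same quantity for `(θ', u^{(i)})` moving to `θ`. The ratios are `y_i
/ x`, and selecting `k` by weight and accepting with `min 1 a`, where `a` is their mean, has flow `x
· (y_k / (x N a)) · min 1 a = N⁻¹ · y_k · min 1 a⁻¹` (`mul_choice_mul_min`). This is the flow of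
branch 2 started at `u^{(k)}` and proposing `z`, that is, after the swap.

Integrating over `θ, θ'` and exchanging the two parameter integrals gives the balance of the
branches under the posterior, and `isReversible_halfMix` concludes. -/

/-! ### Selection probabilities. -/

theorem choice_eq_div {ι : Type*} [Fintype ι] {w : ι → ℝ≥0∞} (h0 : ∑ i, w i ≠ 0)
    (ht : ∑ i, w i ≠ ∞) (k : ι) : choice w k = w k / ∑ i, w i := by
  simp [choice, h0, ht]

theorem sum_choice {ι : Type*} [Fintype ι] [Nonempty ι] (w : ι → ℝ≥0∞) :
    ∑ k, choice w k = 1 := by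
  unfold choice
  split_ifs with h
  · rw [Finset.sum_const, Finset.card_univ, nsmul_eq_mul]
    exact ENNReal.mul_inv_cancel (by simp) (by simp)
  · push Not at h
    simp_rw [div_eq_mul_inv]
    rw [← Finset.sum_mul]
    exact ENNReal.mul_inv_cancel h.1 h.2

/-- Zero total weight is allowed: the uniform default is then multiplied by zero, and every weight
vanishes. -/
theorem sum_mul_choice {ι : Type*} [Fintype ι] {w : ι → ℝ≥0∞} (ht : ∑ i, w i ≠ ∞) (k : ι) :
    (∑ i, w i) * choice w k = w k := by
  by_cases h0 : ∑ i, w i = 0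
  · rw [h0, zero_mul]
    exact ((Finset.sum_eq_zero_iff.1 h0) k (Finset.mem_univ _)).symm
  · rw [choice_eq_div h0 ht, ENNReal.mul_div_cancel h0 ht]

theorem choice_comp_equiv {ι κ : Type*} [Fintype ι] [Fintype κ] (e : κ ≃ ι) (w : ι → ℝ≥0∞)
    (k : κ) : choice (fun i => w (e i)) k = choice w (e k) := by
  simp only [choice, Equiv.sum_comp e w, Fintype.card_congr e]

/-- A factor in `(0, ∞)` also preserves whether the total is `0` or `∞`, so the uniform default is
used on both sides or on neither. -/
theorem choice_mul_const {ι : Type*} [Fintype ι] (w : ι → ℝ≥0∞) {c : ℝ≥0∞} (h0 : c ≠ 0)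
    (ht : c ≠ ∞) (k : ι) : choice (fun i => w i * c) k = choice w k := by
  simp only [choice, ← Finset.sum_mul, mul_eq_zero, h0, or_false, ENNReal.mul_eq_top, ht,
    and_false, false_or, not_false_eq_true, and_true, ne_eq]
  congr 1
  exact ENNReal.mul_div_mul_right _ _ h0 ht

/-- Two products of factors along a chain agree if they agree factor by factor, except possibly
where the factor of the second product that follows vanishes. -/
theorem prod_mul_last_eq {n : ℕ} (a b : Fin n → ℝ≥0∞) (w : Fin (n + 1) → ℝ≥0∞)
    (h : ∀ t, a t = w t.castSucc * b t ∨ w t.succ = 0) :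
    (∏ t, a t) * w (Fin.last n) = (∏ t, w t.castSucc * b t) * w (Fin.last n) := by
  induction n with
  | zero => simp
  | succ n ih =>
    have := ih (fun t => a t.succ) (fun t => b t.succ) (fun t => w t.succ) fun t => by
      simpa using h t.succ
    rw [Fin.prod_univ_succ, mul_assoc, ← Fin.succ_last, this, Fin.prod_univ_succ, mul_assoc]
    rcases h 0 with h0 | h0
    · rw [h0]; rfl
    -- The vanishing weight is a factor of the product over later times, or is the last weight
    -- itself when that product is empty; both sides are zero.
    · suffices (∏ t : Fin n, w t.castSucc.succ * b t.succ) * w (Fin.last n).succ = 0 by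
        simp only [Fin.succ_castSucc] at this
        simp only [Fin.succ_castSucc]
        rw [this, mul_zero, mul_zero]
      cases n with
      | zero => simpa using h0
      | succ n =>
        rw [Fin.prod_univ_succ]
        simp only [Fin.castSucc_zero, h0, zero_mul]

/-! ### Product measures: integrals of products, Markov chains, relabelling. -/

theorem lintegral_pi_prod_fin {X : Type*} [MeasurableSpace X] (ν : Measure X) [SigmaFinite ν] :
    ∀ (m : ℕ) (d : Fin m → X → ℝ≥0∞), (∀ i, Measurable (d i)) →
      ∫⁻ v, ∏ i, d i (v i) ∂(Measure.pi fun _ : Fin m => ν) = ∏ i, ∫⁻ x, d i x ∂ν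
  | 0, d, _ => by simp
  | m + 1, d, hd => by
    have hm := measurePreserving_piFinSuccAbove (fun _ : Fin (m + 1) => ν) 0
    have ih := lintegral_pi_prod_fin ν m (fun i => d i.succ) fun i => hd _
    rw [Fin.prod_univ_succ, ← ih, ← lintegral_prod_mul (hd 0).aemeasurable
      (Measurable.aemeasurable (by fun_prop)),
      ← hm.lintegral_comp_emb (MeasurableEquiv.measurableEmbedding _)]
    refine lintegral_congr fun v => ?_
    rw [Fin.prod_univ_succ]
    rfl

theorem lintegral_pi_prod {ι X : Type*} [Fintype ι] [MeasurableSpace X] (ν : Measure X)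
    [SigmaFinite ν] (d : ι → X → ℝ≥0∞) (hd : ∀ i, Measurable (d i)) :
    ∫⁻ v, ∏ i, d i (v i) ∂(Measure.pi fun _ : ι => ν) = ∏ i, ∫⁻ x, d i x ∂ν := by
  have hm := measurePreserving_piCongrLeft (fun _ : ι => ν) (Fintype.equivFin ι).symm
  rw [← hm.lintegral_comp_emb (MeasurableEquiv.measurableEmbedding _),
    ← Equiv.prod_comp (Fintype.equivFin ι).symm, ← lintegral_pi_prod_fin ν _ _ fun i => hd _]
  refine lintegral_congr fun v => ?_
  rw [← Equiv.prod_comp (Fintype.equivFin ι).symm]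
  refine Finset.prod_congr rfl fun i _ => ?_
  congr 1
  exact Equiv.piCongrLeft_apply_apply (fun _ : ι => X) _ v i

/-- The density of a Markov chain has total mass one. -/
theorem lintegral_chain {X : Type*} [MeasurableSpace X] (ν : Measure X) [SigmaFinite ν] :
    ∀ (n : ℕ) (d₀ : X → ℝ≥0∞) (d : Fin n → X → X → ℝ≥0∞), Measurable d₀ →
      (∀ t, Measurable fun p : X × X => d t p.1 p.2) → ∫⁻ x, d₀ x ∂ν = 1 →
      (∀ t x, ∫⁻ x', d t x x' ∂ν = 1) →
      ∫⁻ v, d₀ (v 0) * ∏ t, d t (v t.castSucc) (v t.succ) ∂(Measure.pi fun _ : Fin (n + 1) => ν) = 1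
  | 0, d₀, _, h₀, _, hi, _ => by
    have hm := measurePreserving_funUnique ν (Fin 1)
    rw [← hi, ← hm.lintegral_comp_emb (MeasurableEquiv.measurableEmbedding _)]
    refine lintegral_congr fun v => ?_
    simp
  | n + 1, d₀, d, h₀, h, hi, hd => by
    have hm := measurePreserving_piFinSuccAbove (fun _ : Fin (n + 1 + 1) => ν) 0
    have hd' (t) : Measurable (Function.uncurry (d t)) := h t
    have hF : Measurable fun p : X × (Fin (n + 1) → X) => d₀ p.1 * (d 0 p.1 (p.2 0) *
        ∏ t : Fin n, d t.succ (p.2 t.castSucc) (p.2 t.succ)) := by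
      refine (by fun_prop : Measurable fun p : X × (Fin (n + 1) → X) => d₀ p.1).mul
        (((h 0).comp (f := fun p : X × (Fin (n + 1) → X) => (p.1, p.2 0)) (by fun_prop)).mul
        (Finset.measurable_prod _ fun t _ => ?_))
      exact (h t.succ).comp (f := fun p : X × (Fin (n + 1) → X) =>
        (p.2 t.castSucc, p.2 t.succ)) (by fun_prop)
    calc _ = ∫⁻ p, d₀ p.1 * (d 0 p.1 (p.2 0) *
          ∏ t : Fin n, d t.succ (p.2 t.castSucc) (p.2 t.succ))
          ∂(ν.prod (Measure.pi fun _ : Fin (n + 1) => ν)) := by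
          rw [← hm.lintegral_comp_emb (MeasurableEquiv.measurableEmbedding _)]
          refine lintegral_congr fun v => ?_
          rw [Fin.prod_univ_succ]
          rfl
      _ = ∫⁻ x, d₀ x * 1 ∂ν := by
          rw [lintegral_prod _ hF.aemeasurable]
          refine lintegral_congr fun x => ?_
          dsimp only
          have hx : Measurable fun v : Fin (n + 1) → X => d 0 x (v 0) *
              ∏ t : Fin n, d t.succ (v t.castSucc) (v t.succ) := by
            refine ((h 0).comp (f := fun v : Fin (n + 1) → X => (x, v 0)) (by fun_prop)).mul
              (Finset.measurable_prod _ fun t _ => ?_)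
            exact (h t.succ).comp (f := fun v : Fin (n + 1) → X =>
              (v t.castSucc, v t.succ)) (by fun_prop)
          -- Given the first state `x`, the remaining states form a chain with initial density `d 0
          -- x`.
          rw [lintegral_const_mul _ hx, lintegral_chain ν n (d 0 x) (fun t => d t.succ)
            ((h 0).comp (by fun_prop : Measurable fun y => (x, y))) (fun t => h _) (hd 0 x)
            fun t => hd _]
      _ = 1 := by simpa using hi

/-- Turns an integral over a reference path and the free particles into one over the whole swarm.
The coordinates are regrouped by time (`h1`), then label `0` is split from the others at each time
(`h2`). -/
theorem measurePreserving_insertPath {Z : Type*} [MeasurableSpace Z] (lam : Measure Z)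
    [SigmaFinite lam] (n M : ℕ) [NeZero M] :
    MeasurePreserving (fun p : Path Z n × (Fin (n + 1) → {i : Fin M // i ≠ 0} → Z) =>
        insertPath p.1 p.2)
      ((Measure.pi fun _ => lam).prod (Measure.pi fun _ => Measure.pi fun _ => lam))
      (Measure.pi fun _ => Measure.pi fun _ => lam) := by
  have h1 := (measurePreserving_arrowProdEquivProdArrow Z ({i : Fin M // i ≠ 0} → Z)
    (Fin (n + 1)) (fun _ => lam) (fun _ => Measure.pi fun _ => lam)).symm
  have h2 : MeasurePreserving (fun (p : Z × ({i : Fin M // i ≠ 0} → Z)) (i : Fin M) =>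
      if hi : i = 0 then p.1 else p.2 ⟨i, hi⟩)
      (lam.prod (Measure.pi fun _ => lam)) (Measure.pi fun _ => lam) := by
    have e1 := (measurePreserving_piEquivPiSubtypeProd (fun _ : Fin M => lam) (fun i => i = 0)).symm
    have e2 : MeasurePreserving (MeasurableEquiv.funUnique {i : Fin M // i = 0} Z).symm lam
        (@Measure.pi _ _ (Subtype.fintype fun i : Fin M => i = 0) _ fun _ => lam) := by
      convert (measurePreserving_funUnique lam {i : Fin M // i = 0}).symm
    have e3 := e1.comp (e2.prod (MeasurePreserving.id
      (Measure.pi fun _ : {i : Fin M // ¬ i = 0} => lam)))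
    exact e3
  exact (measurePreserving_pi _ _ fun _ => h2).comp h1

theorem measurePreserving_permute {Z : Type*} [MeasurableSpace Z] (lam : Measure Z)
    [SigmaFinite lam] {n M : ℕ} (s : Fin (n + 1) → Equiv.Perm (Fin M)) :
    MeasurePreserving (fun (ζ : Swarm Z n M) t i => ζ t (s t i))
      (Measure.pi fun _ => Measure.pi fun _ => lam)
      (Measure.pi fun _ => Measure.pi fun _ => lam) := by
  refine measurePreserving_pi (fun _ => Measure.pi fun _ : Fin M => lam) _
    (f := fun t (x : Fin M → Z) i => x (s t i)) fun t => ?_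
  convert measurePreserving_piCongrLeft (fun _ : Fin M => lam) (s t).symm with ζ i
  have := Equiv.piCongrLeft_apply_apply (fun _ : Fin M => Z) (s t).symm ζ (s t i)
  rw [Equiv.symm_apply_apply] at this
  exact this.symm

/-! ### Densities of the particle systems and their symmetry. -/

namespace Setting

variable {Θ Z Y : Type*} [MeasurableSpace Θ] [MeasurableSpace Z] {σ : Measure Θ}
  {lam : Measure Z} {n : ℕ} (S : Setting Θ Z Y σ lam n)

/-- The density of the particles of an unconditional SMC algorithm. -/
def swarmDensity {M : ℕ} (θ : Θ) (ζ : Swarm Z n M) : ℝ≥0∞ :=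
  (∏ i : Fin M, (S.h θ (ζ 0 i) : ℝ≥0∞)) *
    ∏ t : Fin n, ∏ i : Fin M, ∑ j : Fin M,
      choice (fun l => S.weight θ t.castSucc (ζ t.castSucc l)) j *
        (S.H θ (ζ t.castSucc j) (ζ t.succ i) : ℝ≥0∞)

/-- The product over time of the total weights of the particles. -/
def weightProd {M : ℕ} (θ : Θ) (ζ : Swarm Z n M) : ℝ≥0∞ :=
  ∏ t : Fin (n + 1), ∑ j, S.weight θ t (ζ t j)

theorem weight_ne_top (θ : Θ) (t : Fin (n + 1)) (a : Z) : S.weight θ t a ≠ ∞ := by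
  unfold weight
  split_ifs <;> exact ENNReal.coe_ne_top

/-- Where `h` vanishes so does `μ`, by domination, so the default value of the quotient does no
harm. -/
theorem h_mul_weight_zero (θ : Θ) (a : Z) :
    (S.h θ a : ℝ≥0∞) * S.weight θ 0 a = (S.μ θ a * S.g θ a (S.y 0) : ℝ≥0) := by
  rw [weight, if_pos rfl, ← ENNReal.coe_mul]
  congr 1
  by_cases h : S.h θ a = 0
  · have : S.μ θ a = 0 := by
      by_contra h'
      exact S.h_ne_zero θ a h' h
    simp [this]
  · field_simp

theorem weight_succ (θ : Θ) (t : Fin n) (a : Z) :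
    S.weight θ t.succ a = (S.ρ θ a : ℝ≥0∞) * S.g θ a (S.y t.succ) := by
  rw [weight, if_neg (Fin.succ_ne_zero t), ENNReal.coe_mul]

/-- Rewrites the model density in terms of the proposals `h`, `H` and the weights, the form that is
compared with the law of the particles. -/
theorem joint_eq (θ : Θ) (z : Path Z n) :
    (S.joint θ z : ℝ≥0∞) = S.h θ (z 0) * ((∏ t : Fin n, S.weight θ t.castSucc (z t.castSucc) *
      (S.H θ (z t.castSucc) (z t.succ) : ℝ≥0∞)) * S.weight θ (Fin.last n) (z (Fin.last n))) := by
  have h1 : (∏ t : Fin n, S.weight θ t.castSucc (z t.castSucc)) *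
      S.weight θ (Fin.last n) (z (Fin.last n)) =
      S.weight θ 0 (z 0) * ∏ t : Fin n, S.weight θ t.succ (z t.succ) := by
    rw [← Fin.prod_univ_castSucc (fun t => S.weight θ t (z t)), Fin.prod_univ_succ]
  rw [Finset.prod_mul_distrib, mul_right_comm, h1, ← mul_assoc, ← mul_assoc, h_mul_weight_zero]
  simp only [joint, weight_succ, S.f_eq, Fin.prod_univ_succ (fun t => S.g θ (z t) (S.y t))]
  push_cast
  simp only [Finset.prod_mul_distrib]
  ring

/-- In a backward step the weights are `w_t f = w_t H ρ`, and `ρ` depends only on the later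
particle, so it cancels in `choice`. Each factor `w_t H` along the lineage is thus a backward
probability times `∑ j, w_t H`, and that sum is the total weight times the mixture density that
proposes the later particle. -/
theorem weight_chain_eq {M : ℕ} (θ : Θ) (ζ : Swarm Z n M) (k : Lineage n M) :
    (∏ t : Fin n, S.weight θ t.castSucc (ζ t.castSucc (k t.castSucc)) *
        (S.H θ (ζ t.castSucc (k t.castSucc)) (ζ t.succ (k t.succ)) : ℝ≥0∞)) *
      S.weight θ (Fin.last n) (ζ (Fin.last n) (k (Fin.last n))) =
    (∏ t : Fin n, ∑ j, choice (fun l => S.weight θ t.castSucc (ζ t.castSucc l)) j *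
      (S.H θ (ζ t.castSucc j) (ζ t.succ (k t.succ)) : ℝ≥0∞)) *
      (S.weightProd θ ζ * S.backwardProb θ ζ k) := by
  have hfin (t : Fin (n + 1)) : ∑ j, S.weight θ t (ζ t j) ≠ ∞ :=
    ENNReal.sum_ne_top.2 fun j _ => S.weight_ne_top _ _ _
  have key := prod_mul_last_eq
    (fun t : Fin n => (∑ j, S.weight θ t.castSucc (ζ t.castSucc j) *
      (S.H θ (ζ t.castSucc j) (ζ t.succ (k t.succ)) : ℝ≥0∞)) *
        choice (fun i => S.weight θ t.castSucc (ζ t.castSucc i) *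
          (S.f θ (ζ t.castSucc i) (ζ t.succ (k t.succ)) : ℝ≥0∞)) (k t.castSucc))
    (fun t => (S.H θ (ζ t.castSucc (k t.castSucc)) (ζ t.succ (k t.succ)) : ℝ≥0∞))
    (fun t => S.weight θ t (ζ t (k t))) fun t => by
      -- If `ρ` vanishes, the backward choice falls back to the uniform default and the factors need
      -- not agree; but then the next weight contains `ρ` and is zero.
      by_cases hρ : S.ρ θ (ζ t.succ (k t.succ)) = 0
      · right
        simp [weight_succ, hρ]
      · left
        simp only [S.f_eq, ENNReal.coe_mul, ← mul_assoc]
        rw [choice_mul_const _ (by simpa using hρ) ENNReal.coe_ne_top, sum_mul_choice]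
        exact ENNReal.sum_ne_top.2 fun j _ =>
          ENNReal.mul_ne_top (S.weight_ne_top _ _ _) ENNReal.coe_ne_top
  rw [← key, weightProd, backwardProb, Fin.prod_univ_castSucc,
    ← sum_mul_choice (hfin (Fin.last n)) (k (Fin.last n))]
  have hs (t : Fin n) : ∑ j, S.weight θ t.castSucc (ζ t.castSucc j) *
      (S.H θ (ζ t.castSucc j) (ζ t.succ (k t.succ)) : ℝ≥0∞) =
      (∑ j, S.weight θ t.castSucc (ζ t.castSucc j)) *
        ∑ j, choice (fun l => S.weight θ t.castSucc (ζ t.castSucc l)) j *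
          (S.H θ (ζ t.castSucc j) (ζ t.succ (k t.succ)) : ℝ≥0∞) := by
    rw [Finset.mul_sum]
    refine Finset.sum_congr rfl fun j _ => ?_
    rw [← mul_assoc, sum_mul_choice (hfin t.castSucc)]
  simp only [hs, Finset.prod_mul_distrib]
  ring

/-- The law of the particles of conditional SMC with a reference path drawn from the joint
density, in terms of the law of the particles of SMC and of backward sampling. -/
theorem joint_mul_cSMCDensity {M : ℕ} [NeZero M] (θ : Θ) (ζ : Swarm Z n M) :
    (S.joint θ (fun t => ζ t 0) : ℝ≥0∞) * S.cSMCDensity θ ζ =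
      S.swarmDensity θ ζ * S.weightProd θ ζ * S.backwardProb θ ζ 0 := by
  -- The mixture factors of lineage `0`, with the factor `h` from `joint_eq`, are exactly the
  -- particle-`0` factors that `cSMCDensity` omits from `swarmDensity`.
  have hc := S.weight_chain_eq θ ζ 0
  simp only [Pi.zero_apply] at hc
  rw [joint_eq, hc, cSMCDensity, swarmDensity,
    Fintype.prod_eq_mul_prod_subtype_ne (fun i : Fin M => (S.h θ (ζ 0 i) : ℝ≥0∞)) 0]
  simp only [fun t : Fin n => Fintype.prod_eq_mul_prod_subtype_ne (fun i : Fin M =>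
    ∑ j : Fin M, choice (fun l => S.weight θ t.castSucc (ζ t.castSucc l)) j *
        (S.H θ (ζ t.castSucc j) (ζ t.succ i) : ℝ≥0∞)) 0, Finset.prod_mul_distrib]
  ring

section permute

variable {M : ℕ} (s : Fin (n + 1) → Equiv.Perm (Fin M)) (θ : Θ) (ζ : Swarm Z n M)

theorem weightProd_permute : S.weightProd θ (fun t i => ζ t (s t i)) = S.weightProd θ ζ :=
  Finset.prod_congr rfl fun t _ => Equiv.sum_comp (s t) fun j => S.weight θ t (ζ t j)

theorem swarmDensity_permute : S.swarmDensity θ (fun t i => ζ t (s t i)) = S.swarmDensity θ ζ := by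
  unfold swarmDensity
  congr 1
  · exact Equiv.prod_comp (s 0) fun i => (S.h θ (ζ 0 i) : ℝ≥0∞)
  · refine Finset.prod_congr rfl fun t _ => ?_
    refine Eq.trans (Finset.prod_congr rfl fun i _ => ?_) (Equiv.prod_comp (s t.succ) fun i =>
      ∑ j, choice (fun l => S.weight θ t.castSucc (ζ t.castSucc l)) j *
        (S.H θ (ζ t.castSucc j) (ζ t.succ i) : ℝ≥0∞))
    refine Eq.trans (Finset.sum_congr rfl fun j _ => ?_) (Equiv.sum_comp (s t.castSucc) fun j =>
      choice (fun l => S.weight θ t.castSucc (ζ t.castSucc l)) j *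
        (S.H θ (ζ t.castSucc j) (ζ t.succ (s t.succ i)) : ℝ≥0∞))
    rw [choice_comp_equiv (s t.castSucc) fun l => S.weight θ t.castSucc (ζ t.castSucc l)]

theorem backwardProb_permute (k : Lineage n M) :
    S.backwardProb θ (fun t i => ζ t (s t i)) k = S.backwardProb θ ζ fun t => s t (k t) := by
  unfold backwardProb
  congr 1
  · exact choice_comp_equiv (s _) (fun i => S.weight θ _ (ζ _ i)) _
  · refine Finset.prod_congr rfl fun t _ => ?_
    exact choice_comp_equiv (s t.castSucc) (fun i => S.weight θ t.castSucc (ζ t.castSucc i) *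
      (S.f θ (ζ t.castSucc i) (ζ t.succ (s t.succ (k t.succ))) : ℝ≥0∞)) _

end permute

theorem sum_backwardProb {M : ℕ} [NeZero M] (θ : Θ) (ζ : Swarm Z n M) :
    ∑ k, S.backwardProb θ ζ k = 1 := by
  have key : ∀ (m : ℕ) (a : Fin M → ℝ≥0∞) (b : Fin m → Fin M → Fin M → ℝ≥0∞), ∑ i, a i = 1 →
      (∀ t j, ∑ i, b t j i = 1) →
      ∑ k : Fin (m + 1) → Fin M, a (k (Fin.last m)) * ∏ t : Fin m, b t (k t.succ) (k t.castSucc)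
        = 1 := by
    intro m
    induction m with
    | zero =>
      intro a b ha _
      rw [← ha, ← Equiv.sum_comp (Equiv.funUnique (Fin 1) (Fin M))]
      simp
    | succ m ih =>
      intro a b ha hb
      -- The earliest index occurs only in its own conditional probability given the next one, so it
      -- is summed out first.
      rw [← Equiv.sum_comp (Fin.consEquiv fun _ => Fin M), Fintype.sum_prod_type_right,
        ← ih a (fun t => b t.succ) ha fun t => hb _]
      refine Finset.sum_congr rfl fun k _ => ?_
      simp only [Fin.consEquiv, Equiv.coe_fn_mk, Fin.prod_univ_succ, Fin.castSucc_zero,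
        Fin.cons_zero, Fin.cons_succ, ← Fin.succ_last, ← Fin.succ_castSucc]
      simp only [mul_left_comm (a _)]
      rw [← Finset.sum_mul, hb, one_mul]
  exact key n (fun i => choice (fun l => S.weight θ (Fin.last n) (ζ (Fin.last n) l)) i)
    (fun t j i => choice (fun l => S.weight θ t.castSucc (ζ t.castSucc l) *
      (S.f θ (ζ t.castSucc l) (ζ t.succ j) : ℝ≥0∞)) i) (sum_choice _) fun t j => sum_choice _

end Setting

/-! ### Total mass: the kernels of the algorithm are Markov. -/

section discreteKernel

variable {ι α β : Type*} [Fintype ι] [MeasurableSpace α] [MeasurableSpace β]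
  {p : ι → α → ℝ≥0∞} {F : ι → α → β} (hp : ∀ i, Measurable (p i)) (hF : ∀ i, Measurable (F i))

theorem lintegral_discreteKernel (a : α) {g : β → ℝ≥0∞} (hg : Measurable g) :
    ∫⁻ b, g b ∂(discreteKernel p F hp hF a) = ∑ i, p i a * g (F i a) := by
  change ∫⁻ b, g b ∂(∑ i, p i a • Measure.dirac (F i a)) = _
  rw [lintegral_finsetSum_measure]
  simp [lintegral_dirac' _ hg]

theorem isMarkovKernel_discreteKernel (h : ∀ a, ∑ i, p i a = 1) :
    IsMarkovKernel (discreteKernel p F hp hF) := by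
  refine ⟨fun a => ⟨?_⟩⟩
  rw [← lintegral_one, lintegral_discreteKernel hp hF a measurable_const]
  simpa using h a

end discreteKernel

theorem isMarkovKernel_halfMix {α β : Type*} [MeasurableSpace α] [MeasurableSpace β]
    (κ κ' : Kernel α β) [IsMarkovKernel κ] [IsMarkovKernel κ'] : IsMarkovKernel (halfMix κ κ') := by
  refine ⟨fun a => ⟨?_⟩⟩
  change ((2⁻¹ : ℝ≥0∞) • κ a + (2⁻¹ : ℝ≥0∞) • κ' a) Set.univ = 1
  simp [ENNReal.inv_two_add_inv_two]

theorem isMarkovKernel_withDensity {α β : Type*} [MeasurableSpace α] [MeasurableSpace β]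
    (κ : Kernel α β) [IsSFiniteKernel κ] {f : α → β → ℝ≥0∞}
    (hf : Measurable (Function.uncurry f)) (h : ∀ a, ∫⁻ b, f a b ∂(κ a) = 1) :
    IsMarkovKernel (κ.withDensity f) := by
  refine ⟨fun a => ⟨?_⟩⟩
  rw [Kernel.withDensity_apply' _ hf, setLIntegral_univ, h]

theorem sum_prod_eq_one {ι κ : Type*} [Fintype ι] [DecidableEq ι] [Fintype κ] {p : κ → ℝ≥0∞}
    (hp : ∑ k, p k = 1) :
    ∑ K : ι → κ, ∏ i, p (K i) = 1 := by
  have := Finset.prod_univ_sum (fun _ : ι => (Finset.univ : Finset κ)) fun _ k => p k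
  rw [Fintype.piFinset_univ] at this
  rw [← this]
  simp [hp]

namespace Setting

variable {Θ Z Y : Type*} [MeasurableSpace Θ] [MeasurableSpace Z] {σ : Measure Θ}
  {lam : Measure Z} {n : ℕ} (S : Setting Θ Z Y σ lam n)

theorem measurable_swarm_weight {α : Type*} [MeasurableSpace α] {M : ℕ} {a : α → Θ}
    {ζ : α → Swarm Z n M} (ha : Measurable a) (hζ : Measurable ζ) (t : Fin (n + 1)) (i : Fin M) :
    Measurable fun x => S.weight (a x) t (ζ x t i) :=
  (S.measurable_weight t).comp (ha.prodMk (by fun_prop))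

theorem measurable_mixture {α : Type*} [MeasurableSpace α] {M : ℕ} {a : α → Θ}
    {ζ : α → Swarm Z n M} {b : α → Z} (ha : Measurable a) (hζ : Measurable ζ) (hb : Measurable b)
    (t : Fin (n + 1)) : Measurable fun x => ∑ j : Fin M,
      choice (fun l => S.weight (a x) t (ζ x t l)) j * (S.H (a x) (ζ x t j) (b x) : ℝ≥0∞) := by
  refine Finset.measurable_sum _ fun j _ =>
    (measurable_choice (fun l => S.measurable_swarm_weight ha hζ t l) j).mul ?_
  exact (S.measurable_H.comp (ha.prodMk ((by fun_prop : Measurable fun x => ζ x t j).prodMk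
    hb))).coe_nnreal_ennreal

theorem measurable_cSMCDensity {α : Type*} [MeasurableSpace α] {M : ℕ} [NeZero M] {a : α → Θ}
    {ζ : α → Swarm Z n M} (ha : Measurable a) (hζ : Measurable ζ) :
    Measurable fun x => S.cSMCDensity (a x) (ζ x) := by
  refine (Finset.measurable_prod _ fun i _ => ?_).mul
    (Finset.measurable_prod _ fun t _ => Finset.measurable_prod _ fun i _ =>
      S.measurable_mixture ha hζ (by fun_prop) _)
  exact (S.measurable_h.comp (ha.prodMk (by fun_prop :
    Measurable fun x => ζ x 0 i))).coe_nnreal_ennreal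

theorem measurable_swarmDensity {M : ℕ} (θ : Θ) :
    Measurable fun ζ : Swarm Z n M => S.swarmDensity θ ζ := by
  refine (Finset.measurable_prod _ fun i _ => ?_).mul
    (Finset.measurable_prod _ fun t _ => Finset.measurable_prod _ fun i _ =>
      S.measurable_mixture measurable_const measurable_id (by fun_prop) _)
  exact (S.measurable_h.comp (measurable_const.prodMk (by fun_prop :
    Measurable fun ζ : Swarm Z n M => ζ 0 i))).coe_nnreal_ennreal

theorem measurable_weightProd {M : ℕ} (θ : Θ) :
    Measurable fun ζ : Swarm Z n M => S.weightProd θ ζ :=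
  Finset.measurable_prod _ fun t _ => Finset.measurable_sum _ fun j _ =>
    S.measurable_swarm_weight measurable_const measurable_id t j

theorem lintegral_cSMCDensity [SigmaFinite lam] (M : ℕ) [NeZero M] (θ : Θ) (z : Path Z n) :
    ∫⁻ v, S.cSMCDensity θ (insertPath z v)
      ∂(Measure.pi fun _ : Fin (n + 1) => Measure.pi fun _ : {i : Fin M // i ≠ 0} => lam) = 1 := by
  -- A swarm whose free particles are `x` at every time. Only its slice at time `t` is read, which
  -- exhibits the mixture density `K t` as a function of the previous slice alone, as
  -- `lintegral_chain` requires.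
  let c (t : Fin (n + 1)) (x : {i : Fin M // i ≠ 0} → Z) : Swarm Z n M :=
    insertPath z fun _ => x
  have hc (t) : Measurable (c t) := measurable_insertPath.comp
    (measurable_const.prodMk (by fun_prop))
  let K (t : Fin n) (x : {i : Fin M // i ≠ 0} → Z) (b : Z) : ℝ≥0∞ := ∑ j : Fin M,
    choice (fun l => S.weight θ t.castSucc (c t.castSucc x t.castSucc l)) j *
      (S.H θ (c t.castSucc x t.castSucc j) b : ℝ≥0∞)
  have hK (t : Fin n) : Measurable fun p : ({i : Fin M // i ≠ 0} → Z) × Z => K t p.1 p.2 :=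
    S.measurable_mixture (ζ := fun p : ({i : Fin M // i ≠ 0} → Z) × Z => c t.castSucc p.1)
      measurable_const ((hc t.castSucc).comp measurable_fst) measurable_snd _
  have hh : Measurable fun z => (S.h θ z : ℝ≥0∞) :=
    (S.measurable_h.comp (measurable_const.prodMk measurable_id)).coe_nnreal_ennreal
  have hH (a : Z) : Measurable fun b => (S.H θ a b : ℝ≥0∞) :=
    (S.measurable_H.comp (measurable_const.prodMk
      (measurable_const.prodMk measurable_id))).coe_nnreal_ennreal
  have key := lintegral_chain (Measure.pi fun _ : {i : Fin M // i ≠ 0} => lam) n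
    (fun x => ∏ i, (S.h θ (x i) : ℝ≥0∞)) (fun t x x' => ∏ i, K t x (x' i))
    (Finset.measurable_prod _ fun i _ => hh.comp (measurable_pi_apply i))
    (fun t => Finset.measurable_prod _ fun i _ =>
      (hK t).comp (f := fun p : ({i : Fin M // i ≠ 0} → Z) × ({i : Fin M // i ≠ 0} → Z) =>
        (p.1, p.2 i)) (by fun_prop))
    (by rw [lintegral_pi_prod _ _ fun _ => hh]; simp [S.lintegral_h]) fun t x => by
      rw [lintegral_pi_prod lam (fun _ => K t x) fun _ =>
        (hK t).comp (f := fun b => (x, b)) measurable_prodMk_left]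
      refine Finset.prod_eq_one fun i _ => ?_
      rw [lintegral_finsetSum _ fun j _ => (hH _).const_mul _]
      simp only [lintegral_const_mul _ (hH _), S.lintegral_H, mul_one, sum_choice]
  rw [← key]
  refine lintegral_congr fun v => ?_
  unfold cSMCDensity
  congr 1
  · exact Finset.prod_congr rfl fun i _ => by simp [insertPath, i.2]
  · refine Finset.prod_congr rfl fun t _ => Finset.prod_congr rfl fun i _ => ?_
    simp only [K, c, insertPath, i.2, dite_false]

theorem measurable_cSMCDensity_insertPath (M : ℕ) [NeZero M] :
    Measurable (Function.uncurry fun (x : Θ × Path Z n)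
      (v : Fin (n + 1) → {i : Fin M // i ≠ 0} → Z) => S.cSMCDensity x.1 (insertPath x.2 v)) :=
  S.measurable_cSMCDensity (by fun_prop) (measurable_insertPath.comp
    (f := fun p : (Θ × Path Z n) × (Fin (n + 1) → {i : Fin M // i ≠ 0} → Z) => (p.1.2, p.2))
    (by fun_prop))

instance [SigmaFinite lam] (M : ℕ) [NeZero M] : IsMarkovKernel (S.cSMC M) := by
  have := isMarkovKernel_withDensity (Kernel.const (Θ × Path Z n)
    (Measure.pi fun _ : Fin (n + 1) => Measure.pi fun _ : {i : Fin M // i ≠ 0} => lam))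
    (S.measurable_cSMCDensity_insertPath M)
    fun x => by simpa using S.lintegral_cSMCDensity M x.1 x.2
  exact Kernel.IsMarkovKernel.map _ (measurable_insertPath.comp
    (f := fun p : (Θ × Path Z n) × (Fin (n + 1) → {i : Fin M // i ≠ 0} → Z) => (p.1.2, p.2))
    (by fun_prop))

instance (N M : ℕ) [NeZero M] : IsMarkovKernel (S.backwardPaths N M) :=
  isMarkovKernel_discreteKernel _ _ fun p => sum_prod_eq_one (S.sum_backwardProb p.1 p.2)

instance [SigmaFinite lam] (N M : ℕ) [NeZero M] : IsMarkovKernel (S.cSMCPaths N M) := by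
  unfold cSMCPaths
  infer_instance

instance [SFinite σ] : IsMarkovKernel S.propose :=
  isMarkovKernel_withDensity _ S.measurable_q.coe_nnreal_ennreal fun θ => by
    simpa using S.lintegral_q θ

instance [SFinite σ] [SigmaFinite lam] (N M : ℕ) [NeZero M] (mid : Θ → Θ → Θ)
    (hmid : Measurable fun p : Θ × Θ => mid p.1 p.2) : IsMarkovKernel (S.draw N M mid hmid) := by
  unfold draw
  infer_instance

theorem accept₁_le_one {N : ℕ} (θ θ' : Θ) (z : Path Z n) (u : Fin N → Path Z n) :
    S.accept₁ θ θ' z u ≤ 1 := min_le_left _ _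

theorem accept₂_le_one {N : ℕ} (θ θ' : Θ) (z z' : Path Z n) (u : Fin N → Path Z n) :
    S.accept₂ θ θ' z z' u ≤ 1 := by
  unfold accept₂
  split_ifs
  · exact zero_le
  · exact min_le_left _ _

instance (N : ℕ) [NeZero N] : IsMarkovKernel (S.move₁ N) :=
  isMarkovKernel_discreteKernel _ _ fun p => by
    simp only [Fintype.sum_prod_type, Fintype.sum_bool, cond_true, cond_false, ← mul_add,
      add_tsub_cancel_of_le (S.accept₁_le_one _ _ _ _), mul_one]
    exact sum_choice _

instance (N : ℕ) [NeZero N] : IsMarkovKernel (S.move₂ N) :=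
  isMarkovKernel_discreteKernel _ _ fun p => by
    simp only [Fintype.sum_prod_type, Fintype.sum_bool, cond_true, cond_false, ← mul_add,
      add_tsub_cancel_of_le (S.accept₂_le_one _ _ _ _ _), mul_one]
    simp [ENNReal.mul_inv_cancel, NeZero.ne N]

instance [SFinite σ] [SigmaFinite lam] (N M : ℕ) [NeZero M] [NeZero N] :
    IsMarkovKernel (S.transition N M) := by
  unfold transition
  exact isMarkovKernel_halfMix _ _

/-! ### Exchangeability of the reference path and the backward-sampled paths. -/

theorem lintegral_cSMC [SigmaFinite lam] (M : ℕ) [NeZero M] (x : Θ × Path Z n)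
    {g : Swarm Z n M → ℝ≥0∞} (hg : Measurable g) :
    ∫⁻ ζ, g ζ ∂(S.cSMC M x) = ∫⁻ v, S.cSMCDensity x.1 (insertPath x.2 v) * g (insertPath x.2 v)
      ∂(Measure.pi fun _ : Fin (n + 1) => Measure.pi fun _ : {i : Fin M // i ≠ 0} => lam) := by
  have hi : Measurable fun p : (Θ × Path Z n) × (Fin (n + 1) → {i : Fin M // i ≠ 0} → Z) =>
      insertPath p.1.2 p.2 := measurable_insertPath.comp (f := fun p : (Θ × Path Z n) ×
        (Fin (n + 1) → {i : Fin M // i ≠ 0} → Z) => (p.1.2, p.2)) (by fun_prop)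
  have hd := S.measurable_cSMCDensity_insertPath M
  have := isMarkovKernel_withDensity (Kernel.const (Θ × Path Z n)
    (Measure.pi fun _ : Fin (n + 1) => Measure.pi fun _ : {i : Fin M // i ≠ 0} => lam)) hd
    fun x => by simpa using S.lintegral_cSMCDensity M x.1 x.2
  rw [cSMC, Kernel.lintegral_map _ hi _ hg,
    Kernel.lintegral_id_prod (f := fun p : (Θ × Path Z n) ×
      (Fin (n + 1) → {i : Fin M // i ≠ 0} → Z) => g (insertPath p.1.2 p.2)) (hg.comp hi),
    Kernel.lintegral_withDensity _ hd _ (g := fun v => g (insertPath x.2 v))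
      ((hg.comp hi).comp (measurable_prodMk_left (x := x)))]
  simp

/-- The path of the particles with the labels `k`. -/
def trace {M : ℕ} (ζ : Swarm Z n M) (k : Lineage n M) : Path Z n := fun t => ζ t (k t)

theorem measurable_trace {M : ℕ} (k : Lineage n M) :
    Measurable fun ζ : Swarm Z n M => trace ζ k := by
  unfold trace
  fun_prop

theorem lintegral_cSMCPaths [SigmaFinite lam] (N M : ℕ) [NeZero M] (x : Θ × Path Z n)
    {g : (Fin N → Path Z n) → ℝ≥0∞} (hg : Measurable g) :
    ∫⁻ u, g u ∂(S.cSMCPaths N M x) = ∫⁻ ζ, ∑ K : Fin N → Lineage n M,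
      (∏ i, S.backwardProb x.1 ζ (K i)) * g (fun i => trace ζ (K i)) ∂(S.cSMC M x) := by
  have hm : Measurable fun p : Θ × Swarm Z n M => ∫⁻ u, g u ∂(S.backwardPaths N M p) :=
    hg.lintegral_kernel
  rw [cSMCPaths, Kernel.lintegral_comp _ _ _ hg, Kernel.lintegral_deterministic_prod _ _ _ hm]
  refine lintegral_congr fun ζ => ?_
  rw [backwardPaths, lintegral_discreteKernel _ _ _ hg]
  rfl

theorem measurable_backwardProb_right {M : ℕ} (θ : Θ) (k : Lineage n M) :
    Measurable fun ζ : Swarm Z n M => S.backwardProb θ ζ k :=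
  (S.measurable_backwardProb k).comp (f := fun ζ : Swarm Z n M => (θ, ζ)) measurable_prodMk_left

theorem measurable_backwardProb_mul {N M : ℕ} (θ : Θ) {Γ : Path Z n × (Fin N → Path Z n) → ℝ≥0∞}
    (hΓ : Measurable Γ) (K : Fin N → Lineage n M) :
    Measurable fun p : Path Z n × Swarm Z n M => (∏ i, S.backwardProb θ p.2 (K i)) *
      Γ (p.1, fun i => trace p.2 (K i)) := by
  have h1 : Measurable fun p : Path Z n × Swarm Z n M => ∏ i, S.backwardProb θ p.2 (K i) :=
    Finset.measurable_prod _ fun i _ =>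
      (S.measurable_backwardProb_right θ (K i)).comp
        (f := fun p : Path Z n × Swarm Z n M => p.2) measurable_snd
  have h2 : Measurable fun p : Path Z n × Swarm Z n M => (p.1, fun i => trace p.2 (K i)) :=
    measurable_fst.prodMk (measurable_pi_lambda _ fun i =>
      (measurable_trace (K i)).comp measurable_snd)
  exact h1.mul (hΓ.comp h2)

/-- The left side does not involve `k`: giving the reference label `0` at all times is a convention,
and a relabelling at each time carries lineage `0` to any lineage `k`. This freedom allows averaging
over `k` later. -/
theorem lintegral_joint_cSMCPaths [SigmaFinite lam] (N M : ℕ) [NeZero M] (θ : Θ)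
    {Γ : Path Z n × (Fin N → Path Z n) → ℝ≥0∞} (hΓ : Measurable Γ) (k : Lineage n M) :
    ∫⁻ z, S.joint θ z * ∫⁻ u, Γ (z, u) ∂(S.cSMCPaths N M (θ, z)) ∂(Measure.pi fun _ => lam) =
      ∫⁻ ζ : Swarm Z n M, S.swarmDensity θ ζ * S.weightProd θ ζ * (S.backwardProb θ ζ k *
        ∑ K : Fin N → Lineage n M, (∏ i, S.backwardProb θ ζ (K i)) *
          Γ (trace ζ k, fun i => trace ζ (K i))) ∂(Measure.pi fun _ => Measure.pi fun _ => lam) := by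
  have hG : Measurable fun p : Path Z n × Swarm Z n M =>
      ∑ K : Fin N → Lineage n M, (∏ i, S.backwardProb θ p.2 (K i)) *
        Γ (p.1, fun i => trace p.2 (K i)) :=
    Finset.measurable_sum _ fun K _ => S.measurable_backwardProb_mul θ hΓ K
  have hj : Measurable fun z => (S.joint θ z : ℝ≥0∞) :=
    (S.measurable_joint.comp measurable_prodMk_left).coe_nnreal_ennreal
  have hi := measurePreserving_insertPath lam n M
  let G (ζ : Swarm Z n M) : ℝ≥0∞ := S.joint θ (trace ζ 0) * (S.cSMCDensity θ ζ *
    ∑ K : Fin N → Lineage n M, (∏ i, S.backwardProb θ ζ (K i)) *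
      Γ (trace ζ 0, fun i => trace ζ (K i)))
  have hGm : Measurable G :=
    (hj.comp (f := fun ζ : Swarm Z n M => trace ζ 0) (measurable_trace 0)).mul
    ((S.measurable_cSMCDensity measurable_const measurable_id).mul
      (hG.comp (f := fun ζ : Swarm Z n M => (trace ζ 0, ζ))
        ((measurable_trace 0).prodMk measurable_id)))
  have htr (z : Path Z n) (v : Fin (n + 1) → {i : Fin M // i ≠ 0} → Z) :
      trace (insertPath z v) 0 = z := by
    funext t
    simp [trace, insertPath]
  calc _ = ∫⁻ z, ∫⁻ v, G (insertPath z v)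
        ∂(Measure.pi fun _ : Fin (n + 1) => Measure.pi fun _ : {i : Fin M // i ≠ 0} => lam)
        ∂(Measure.pi fun _ => lam) := by
        refine lintegral_congr fun z => ?_
        rw [S.lintegral_cSMCPaths N M _ (g := fun u => Γ (z, u)) (hΓ.comp measurable_prodMk_left),
          S.lintegral_cSMC M _ (g := fun ζ => ∑ K : Fin N → Lineage n M,
            (∏ i, S.backwardProb θ ζ (K i)) * Γ (z, fun i => trace ζ (K i)))
            (hG.comp (f := fun ζ : Swarm Z n M => (z, ζ)) measurable_prodMk_left),
          ← lintegral_const_mul]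
        · refine lintegral_congr fun v => ?_
          simp only [G, htr]
        · refine Measurable.mul ((S.measurable_cSMCDensity_insertPath M).comp
            (measurable_prodMk_left (x := (θ, z)))) ?_
          exact hG.comp (f := fun v => (z, insertPath z v)) (measurable_const.prodMk
            (measurable_insertPath.comp measurable_prodMk_left))
    _ = ∫⁻ ζ, G ζ ∂(Measure.pi fun _ => Measure.pi fun _ => lam) := by
        rw [← hi.lintegral_comp hGm, lintegral_prod (fun p => G (insertPath p.1 p.2))
          (hGm.comp hi.measurable).aemeasurable]
    _ = _ := by
        -- The transposition of `0` and `k t` at time `t`; the swarm factors are invariant, and the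
        -- sum over `K` absorbs the relabelling.
        let s (t : Fin (n + 1)) : Equiv.Perm (Fin M) := Equiv.swap 0 (k t)
        rw [← (measurePreserving_permute lam s).lintegral_comp hGm]
        refine lintegral_congr fun ζ => ?_
        simp only [G]
        have h1 : trace (fun t i => ζ t (s t i)) 0 = trace ζ k := by
          funext t
          simp [trace, s]
        have h2 : (fun t => s t ((0 : Lineage n M) t)) = k := by
          funext t
          simp [s]
        have h3 := S.joint_mul_cSMCDensity θ fun t i => ζ t (s t i)
        rw [show (fun t => ζ t (s t 0)) = trace ζ k from h1, swarmDensity_permute,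
          weightProd_permute, backwardProb_permute, h2] at h3
        rw [← mul_assoc, h1, h3, mul_assoc]
        congr 2
        refine Eq.trans (Finset.sum_congr rfl fun K _ => ?_) (Equiv.sum_comp
          (Equiv.piCongrRight fun _ : Fin N => Equiv.piCongrRight s) fun K =>
            (∏ i, S.backwardProb θ ζ (K i)) * Γ (trace ζ k, fun i => trace ζ (K i)))
        simp only [backwardProb_permute]
        rfl

/-- The reference path of conditional SMC, drawn from the model, and the paths drawn by backward
sampling are exchangeable. -/
theorem lintegral_joint_cSMCPaths_swap [SigmaFinite lam] (N M : ℕ) [NeZero M] (θ : Θ)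
    {Γ : Path Z n × (Fin N → Path Z n) → ℝ≥0∞} (hΓ : Measurable Γ) (j : Fin N) :
    ∫⁻ z, S.joint θ z * ∫⁻ u, Γ (u j, Function.update u j z) ∂(S.cSMCPaths N M (θ, z))
        ∂(Measure.pi fun _ => lam) =
      ∫⁻ z, S.joint θ z * ∫⁻ u, Γ (z, u) ∂(S.cSMCPaths N M (θ, z)) ∂(Measure.pi fun _ => lam) := by
  -- Summing the previous identity over all `k` turns the reference lineage into an extra backward
  -- draw with the same weight as the other `N`. The cardinality is finite and nonzero, and cancels
  -- at the end.
  have hsum {Γ : Path Z n × (Fin N → Path Z n) → ℝ≥0∞} (hΓ : Measurable Γ) :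
      (Fintype.card (Lineage n M) : ℝ≥0∞) *
        ∫⁻ z, S.joint θ z * ∫⁻ u, Γ (z, u) ∂(S.cSMCPaths N M (θ, z)) ∂(Measure.pi fun _ => lam) =
      ∫⁻ ζ : Swarm Z n M, S.swarmDensity θ ζ * S.weightProd θ ζ *
        ∑ kK : Lineage n M × (Fin N → Lineage n M), (S.backwardProb θ ζ kK.1 *
          ∏ i, S.backwardProb θ ζ (kK.2 i)) * Γ (trace ζ kK.1, fun i => trace ζ (kK.2 i))
          ∂(Measure.pi fun _ => Measure.pi fun _ => lam) := by
    rw [← nsmul_eq_mul, ← Finset.card_univ, ← Finset.sum_const,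
      Finset.sum_congr rfl fun k _ => S.lintegral_joint_cSMCPaths N M θ hΓ k,
      ← lintegral_finsetSum]
    · refine lintegral_congr fun ζ => ?_
      rw [← Finset.mul_sum, Fintype.sum_prod_type]
      simp only [Finset.mul_sum, mul_assoc]
    · intro k _
      have hs : Measurable fun ζ : Swarm Z n M => ∑ K : Fin N → Lineage n M,
          (∏ i, S.backwardProb θ ζ (K i)) * Γ (trace ζ k, fun i => trace ζ (K i)) :=
        Finset.measurable_sum _ fun K _ => (S.measurable_backwardProb_mul θ hΓ K).comp
          (f := fun ζ : Swarm Z n M => (trace ζ k, ζ)) ((measurable_trace k).prodMk measurable_id)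
      exact ((S.measurable_swarmDensity θ).mul (S.measurable_weightProd θ)).mul
        ((S.measurable_backwardProb_right θ k).mul hs)
  have hΓ' : Measurable fun p : Path Z n × (Fin N → Path Z n) =>
      Γ (p.2 j, Function.update p.2 j p.1) :=
    hΓ.comp ((by fun_prop : Measurable fun p : Path Z n × (Fin N → Path Z n) => p.2 j).prodMk
      (measurable_update'.comp (measurable_snd.prodMk measurable_fst)))
  have hcard : (Fintype.card (Lineage n M) : ℝ≥0∞) ≠ 0 := by simp [NeZero.ne M]
  rw [← ENNReal.mul_right_inj hcard (ENNReal.natCast_ne_top _), hsum hΓ, hsum hΓ']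
  -- On lineages, the exchange is an involution of the index set that preserves the product of
  -- probabilities.
  have hinv : Function.Involutive fun kK : Lineage n M × (Fin N → Lineage n M) =>
      (kK.2 j, Function.update kK.2 j kK.1) := fun kK => by simp
  refine lintegral_congr fun ζ => ?_
  rw [← Equiv.sum_comp hinv.toPerm]
  congr 1
  refine Finset.sum_congr rfl fun kK _ => ?_
  simp only [Function.Involutive.coe_toPerm, Function.update_self]
  have h1 : S.backwardProb θ ζ (kK.2 j) *
      ∏ i, S.backwardProb θ ζ (Function.update kK.2 j kK.1 i) =
      S.backwardProb θ ζ kK.1 * ∏ i, S.backwardProb θ ζ (kK.2 i) := by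
    rw [Fintype.prod_eq_mul_prod_subtype_ne _ j,
      Fintype.prod_eq_mul_prod_subtype_ne (fun i => S.backwardProb θ ζ (kK.2 i)) j,
      Function.update_self, mul_left_comm]
    congr 2
    exact Finset.prod_congr rfl fun i _ => by rw [Function.update_of_ne i.2]
  have h2 : Function.update (fun i => trace ζ (Function.update kK.2 j kK.1 i)) j
      (trace ζ (kK.2 j)) = fun i => trace ζ (kK.2 i) := by
    funext i
    by_cases hi : i = j
    · subst hi; simp
    · simp [Function.update_of_ne hi]
  rw [h1, h2]

end Setting

/-! ### Balance of the acceptance rules, and reversibility of a mixture. -/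

/-- The balance between choosing an index by its weight and accepting with the mean weight, and
choosing an index uniformly and accepting with the inverse of the mean weight. -/
theorem mul_choice_mul_min {N : ℕ} {x : ℝ≥0∞} {y : Fin N → ℝ≥0∞} (hx : x ≠ ∞)
    (hy : ∀ i, y i ≠ ∞) (k : Fin N) :
    x * (choice (fun i => y i / x) k * min 1 ((N : ℝ≥0∞)⁻¹ * ∑ i, y i / x)) =
      (N : ℝ≥0∞)⁻¹ * (y k * min 1 ((N : ℝ≥0∞)⁻¹ * ∑ i, y i / x)⁻¹) := by
  have hN : (N : ℝ≥0∞) ≠ 0 := by simpa using k.pos.ne'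
  have hN' : (N : ℝ≥0∞) ≠ ∞ := ENNReal.natCast_ne_top N
  -- With `x = 0` the left side vanishes; on the right either `y k = 0`, or the mean ratio is `∞`
  -- and its inverse is zero.
  by_cases hx0 : x = 0
  · by_cases hk : y k = 0
    · simp [hx0, hk]
    · have : ∑ i, y i / x = ∞ := ENNReal.sum_eq_top.2 ⟨k, Finset.mem_univ k, by
        rw [hx0, ENNReal.div_zero hk]⟩
      rw [this, ENNReal.mul_top (ENNReal.inv_ne_zero.2 hN')]
      simp [hx0]
  have hs : ∑ i, y i / x ≠ ∞ :=
    ENNReal.sum_ne_top.2 fun i _ => ENNReal.div_ne_top (hy i) hx0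
  by_cases h0 : ∑ i, y i / x = 0
  · have hk : y k = 0 := by
      have := (Finset.sum_eq_zero_iff.1 h0) k (Finset.mem_univ k)
      simpa [ENNReal.div_eq_zero_iff, hx] using this
    simp [h0, hk]
  rw [choice_eq_div h0 hs]
  set s := ∑ i, y i / x
  have ha0 : (N : ℝ≥0∞)⁻¹ * s ≠ 0 := mul_ne_zero (ENNReal.inv_ne_zero.2 hN') h0
  have hat : (N : ℝ≥0∞)⁻¹ * s ≠ ∞ := ENNReal.mul_ne_top (ENNReal.inv_ne_top.2 hN) hs
  have h1 : s⁻¹ = (N : ℝ≥0∞)⁻¹ * ((N : ℝ≥0∞)⁻¹ * s)⁻¹ := by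
    rw [ENNReal.mul_inv (Or.inr hs) (Or.inr h0), inv_inv, ← mul_assoc,
      ENNReal.inv_mul_cancel hN hN', one_mul]
  have h2 : ((N : ℝ≥0∞)⁻¹ * s)⁻¹ * min 1 ((N : ℝ≥0∞)⁻¹ * s) = min 1 ((N : ℝ≥0∞)⁻¹ * s)⁻¹ := by
    rw [mul_min, mul_one, ENNReal.inv_mul_cancel ha0 hat, min_comm]
  rw [← h2, div_eq_mul_inv _ s, h1, ← mul_assoc, ← mul_assoc, ENNReal.mul_div_cancel hx0 hx]
  ring

theorem div_div_div_eq {a b c d : ℝ≥0∞} (hb : b ≠ 0) (hb' : b ≠ ∞) (hd : d ≠ 0) (hd' : d ≠ ∞) :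
    a / b / (c / d) = a * d / (c * b) := by
  simp only [div_eq_mul_inv]
  rw [ENNReal.mul_inv (Or.inr (ENNReal.inv_ne_top.2 hd)) (Or.inr (ENNReal.inv_ne_zero.2 hd')),
    inv_inv, ENNReal.mul_inv (Or.inr hb') (Or.inr hb)]
  ring

/-- The law of the next state, when a proposal is accepted or the current state is kept. -/
theorem discreteKernel_comp_id_prod_apply {ι X W : Type*} [Fintype ι] [MeasurableSpace X]
    [MeasurableSpace W] (κ : Kernel X W) [IsSFiniteKernel κ] {c α : ι → X × W → ℝ≥0∞}
    {F : ι → X × W → X} (hc : ∀ k, Measurable (c k)) (hα : ∀ k, Measurable (α k))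
    (hF : ∀ k, Measurable (F k))
    (hp : ∀ kb : ι × Bool, Measurable fun p =>
      c kb.1 p * bif kb.2 then α kb.1 p else 1 - α kb.1 p)
    (hG : ∀ kb : ι × Bool, Measurable fun p => bif kb.2 then F kb.1 p else p.1) (x : X) {B : Set X}
    (hB : MeasurableSet B) :
    (discreteKernel (ι := ι × Bool) _ _ hp hG ∘ₖ (Kernel.id ×ₖ κ)) x B =
      (∫⁻ w, ∑ k, c k (x, w) * (α k (x, w) * B.indicator 1 (F k (x, w))) ∂(κ x)) +
      (∫⁻ w, ∑ k, c k (x, w) * (1 - α k (x, w)) ∂(κ x)) * B.indicator 1 x := by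
  have hi : Measurable (B.indicator (1 : X → ℝ≥0∞)) := measurable_one.indicator hB
  have hm1 : Measurable fun p : X × W => ∑ k, c k p * (α k p * B.indicator 1 (F k p)) :=
    Finset.measurable_sum _ fun k _ => (hc k).mul ((hα k).mul (hi.comp (hF k)))
  have hm2 : Measurable fun p : X × W => ∑ k, c k p * (1 - α k p) :=
    Finset.measurable_sum _ fun k _ => (hc k).mul (measurable_const.sub (hα k))
  have hm : Measurable fun p => ∫⁻ b, B.indicator 1 b
      ∂(discreteKernel (ι := ι × Bool) _ _ hp hG p) :=
    hi.lintegral_kernel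
  rw [← lintegral_indicator_one hB, Kernel.lintegral_comp _ _ _ hi,
    Kernel.lintegral_id_prod hm,
    ← lintegral_mul_const (f := fun w => ∑ k, c k (x, w) * (1 - α k (x, w)))
      (B.indicator 1 x) (hm2.comp (measurable_prodMk_left (x := x))),
    ← lintegral_add_left (f := fun w => ∑ k, c k (x, w) * (α k (x, w) *
      B.indicator 1 (F k (x, w)))) (hm1.comp (measurable_prodMk_left (x := x)))]
  refine lintegral_congr fun w => ?_
  rw [lintegral_discreteKernel hp hG _ hi]
  simp only [Fintype.sum_prod_type, Fintype.sum_bool, cond_true, cond_false,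
    Finset.sum_add_distrib, Finset.sum_mul, mul_assoc]

/-- A mixture of two kernels is reversible if the moves of each are balanced by those of the
other. -/
theorem isReversible_halfMix {X : Type*} [MeasurableSpace X] {π : Measure X} {κ₁ κ₂ : Kernel X X}
    {a₁ a₂ : Set X → X → ℝ≥0∞} {r₁ r₂ : X → ℝ≥0∞}
    (ha₁ : ∀ B, MeasurableSet B → Measurable (a₁ B))
    (ha₂ : ∀ B, MeasurableSet B → Measurable (a₂ B))
    (h₁ : ∀ x B, MeasurableSet B → κ₁ x B = a₁ B x + r₁ x * B.indicator 1 x)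
    (h₂ : ∀ x B, MeasurableSet B → κ₂ x B = a₂ B x + r₂ x * B.indicator 1 x)
    (h : ∀ A B, MeasurableSet A → MeasurableSet B →
      ∫⁻ x in A, a₁ B x ∂π = ∫⁻ x in B, a₂ A x ∂π) :
    (halfMix κ₁ κ₂).IsReversible π := by
  -- The mass of staying put is an integral over `A ∩ B`, hence symmetric in `A` and `B`.
  have key {A B : Set X} (hA : MeasurableSet A) (hB : MeasurableSet B) :
      ∫⁻ x in A, halfMix κ₁ κ₂ x B ∂π = 2⁻¹ * (∫⁻ x in A, a₁ B x ∂π) +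
        2⁻¹ * (∫⁻ x in A, a₂ B x ∂π) +
        ∫⁻ x in A ∩ B, 2⁻¹ * r₁ x + 2⁻¹ * r₂ x ∂π := by
    rw [← lintegral_const_mul _ (ha₁ B hB), ← lintegral_const_mul _ (ha₂ B hB),
      ← lintegral_add_left ((ha₁ B hB).const_mul _), Set.inter_comm, ← Measure.restrict_restrict hB,
      ← lintegral_indicator hB, ← lintegral_add_left
        (f := fun x => 2⁻¹ * a₁ B x + 2⁻¹ * a₂ B x)
        (((ha₁ B hB).const_mul _).add ((ha₂ B hB).const_mul _))]
    refine lintegral_congr fun x => ?_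
    change ((2⁻¹ : ℝ≥0∞) • κ₁ x + (2⁻¹ : ℝ≥0∞) • κ₂ x) B = _
    rw [Measure.add_apply, Measure.smul_apply, Measure.smul_apply, h₁ x B hB, h₂ x B hB]
    by_cases hx : x ∈ B
    · simp only [smul_eq_mul, Set.indicator_of_mem hx, Pi.one_apply, mul_one]
      ring
    · simp only [smul_eq_mul, Set.indicator_of_notMem hx, mul_zero, add_zero]
  intro A B hA hB
  rw [key hA hB, key hB hA, h A B hA hB, ← h B A hB hA, Set.inter_comm,
    add_comm (2⁻¹ * ∫⁻ x in B, a₂ A x ∂π)]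

/-! ### The joint law of the paths, and balance for fixed parameters. -/

namespace Setting

variable {Θ Z Y : Type*} [MeasurableSpace Θ] [MeasurableSpace Z] {σ : Measure Θ}
  {lam : Measure Z} {n : ℕ} (S : Setting Θ Z Y σ lam n)

theorem isProbabilityMeasure_posterior (hpos : S.evidence ≠ 0) (hfin : S.evidence ≠ ∞) :
    IsProbabilityMeasure S.posterior := by
  refine ⟨?_⟩
  rw [posterior, Measure.smul_apply, withDensity_apply _ MeasurableSet.univ, setLIntegral_univ]
  exact ENNReal.inv_mul_cancel hpos hfin

theorem measurable_joint_right (θ : Θ) : Measurable fun z : Path Z n => S.joint θ z :=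
  S.measurable_joint.comp (f := fun z : Path Z n => (θ, z)) measurable_prodMk_left

section jointLaw

variable [SigmaFinite lam] (N M : ℕ) [NeZero M] (θ : Θ)

/-- The (unnormalised) law of a path `z` from the model at `θ`, and of `N` paths drawn by
backward sampling from the particles of conditional SMC with reference path `z`. -/
def jointLaw : Measure (Path Z n × (Fin N → Path Z n)) :=
  ((Measure.pi fun _ => lam).withDensity fun z => (S.joint θ z : ℝ≥0∞)) ⊗ₘ
    (S.cSMCPaths N M).comap (fun z => (θ, z)) measurable_prodMk_left

theorem lintegral_jointLaw {F : Path Z n × (Fin N → Path Z n) → ℝ≥0∞} (hF : Measurable F) :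
    ∫⁻ p, F p ∂(S.jointLaw N M θ) = ∫⁻ z, S.joint θ z * ∫⁻ u, F (z, u) ∂(S.cSMCPaths N M (θ, z))
      ∂(Measure.pi fun _ => lam) := by
  have hm : Measurable fun z => ∫⁻ u, F (z, u)
      ∂((S.cSMCPaths N M).comap (fun z => (θ, z)) measurable_prodMk_left z) :=
    hF.lintegral_kernel_prod_right'
  rw [jointLaw, Measure.lintegral_compProd hF,
    lintegral_withDensity_eq_lintegral_mul _ (S.measurable_joint_right θ).coe_nnreal_ennreal hm]
  rfl

theorem lintegral_jointLaw_swap {F : Path Z n × (Fin N → Path Z n) → ℝ≥0∞} (hF : Measurable F)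
    (j : Fin N) :
    ∫⁻ p, F (p.2 j, Function.update p.2 j p.1) ∂(S.jointLaw N M θ) =
      ∫⁻ p, F p ∂(S.jointLaw N M θ) := by
  have hF' : Measurable fun p : Path Z n × (Fin N → Path Z n) =>
      F (p.2 j, Function.update p.2 j p.1) :=
    hF.comp (f := fun p : Path Z n × (Fin N → Path Z n) => (p.2 j, Function.update p.2 j p.1))
      ((by fun_prop : Measurable fun p : Path Z n × (Fin N → Path Z n) => p.2 j).prodMk
        (measurable_update'.comp (measurable_snd.prodMk measurable_fst)))
  rw [lintegral_jointLaw _ _ _ _ hF, lintegral_jointLaw _ _ _ _ hF',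
    S.lintegral_joint_cSMCPaths_swap N M θ hF j]

/-- For the reference path this holds because the law has density `joint θ`; exchangeability
transfers it to each sampled path. It makes the divisions by `joint` legitimate. -/
theorem ae_jointLaw_joint_ne_zero :
    ∀ᵐ p ∂(S.jointLaw N M θ), S.joint θ p.1 ≠ 0 ∧ ∀ i, S.joint θ (p.2 i) ≠ 0 := by
  have hs : MeasurableSet {p : Path Z n × (Fin N → Path Z n) | S.joint θ p.1 = 0} :=
    (S.measurable_joint_right θ).comp measurable_fst (measurableSet_singleton 0)
  have h1 : ∫⁻ p, {p | S.joint θ p.1 = 0}.indicator 1 p ∂(S.jointLaw N M θ) = 0 := by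
    rw [lintegral_jointLaw _ _ _ _ (measurable_one.indicator hs)]
    refine (lintegral_congr fun z => ?_).trans lintegral_zero
    by_cases hz : S.joint θ z = 0
    · simp [hz]
    · simp [Set.indicator, hz]
  have h0 : ∀ᵐ p ∂(S.jointLaw N M θ), S.joint θ p.1 ≠ 0 := by
    rw [lintegral_indicator_one hs] at h1
    rw [ae_iff]
    simpa using h1
  refine h0.and (ae_all_iff.2 fun i => ?_)
  have hi : MeasurableSet {p : Path Z n × (Fin N → Path Z n) | S.joint θ (p.2 i) = 0} :=
    (S.measurable_joint_right θ).comp (f := fun p : Path Z n × (Fin N → Path Z n) => p.2 i)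
      (by fun_prop) (measurableSet_singleton 0)
  have h2 := S.lintegral_jointLaw_swap N M θ (measurable_one.indicator hs) i
  rw [h1] at h2
  have h3 : ∫⁻ p, {p : Path Z n × (Fin N → Path Z n) | S.joint θ (p.2 i) = 0}.indicator 1 p
      ∂(S.jointLaw N M θ) = 0 := h2
  rw [lintegral_indicator_one hi] at h3
  rw [ae_iff]
  simpa using h3

/-- Changes the density of the reference path from `a` to `joint θ`. Where `joint θ` vanishes the
weight `a` may not, so the integrand must; the acceptance probabilities guarantee this in both
branches. -/
theorem lintegral_eq_lintegral_jointLaw {a : Path Z n → ℝ≥0} (ha : Measurable a)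
    {F : Path Z n × (Fin N → Path Z n) → ℝ≥0∞} (hF : Measurable F)
    (h0 : ∀ z u, S.joint θ z = 0 → F (z, u) = 0) :
    ∫⁻ z, a z * ∫⁻ u, F (z, u) ∂(S.cSMCPaths N M (θ, z)) ∂(Measure.pi fun _ => lam) =
      ∫⁻ p, a p.1 / S.joint θ p.1 * F p ∂(S.jointLaw N M θ) := by
  have hm : Measurable fun p : Path Z n × (Fin N → Path Z n) =>
      (a p.1 / S.joint θ p.1 : ℝ≥0∞) * F p :=
    ((ha.comp measurable_fst).coe_nnreal_ennreal.div
      ((S.measurable_joint_right θ).comp measurable_fst).coe_nnreal_ennreal).mul hF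
  rw [lintegral_jointLaw _ _ _ _ hm]
  refine lintegral_congr fun z => ?_
  by_cases hz : S.joint θ z = 0
  · simp [h0 z _ hz]
  · have hz' : (S.joint θ z : ℝ≥0∞) ≠ 0 := by simpa using hz
    dsimp only
    rw [lintegral_const_mul _ (f := fun u => F (z, u)) (hF.comp measurable_prodMk_left), ← mul_assoc,
      ENNReal.mul_div_cancel hz' ENNReal.coe_ne_top]

end jointLaw

theorem measurable_choice_ratio {N : ℕ} (k : Fin N) :
    Measurable fun p : (Θ × Path Z n) × (Θ × (Fin N → Path Z n)) =>
      choice (fun i => S.ratio p.1.1 p.2.1 (S.mid₁ p.1.1 p.2.1) p.1.2 (p.2.2 i)) k :=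
  measurable_choice (fun i => S.measurable_ratio (by fun_prop) (by fun_prop)
    (S.measurable_mid₁.comp (f := fun p : (Θ × Path Z n) × (Θ × (Fin N → Path Z n)) =>
      (p.1.1, p.2.1)) (by fun_prop)) (by fun_prop) (by fun_prop)) k

/-- The density of a move from `(θ, z)` to the parameter `θ'`, up to the normalising constant. -/
def moveDensity (θ θ' : Θ) (z : Path Z n) : ℝ≥0 := S.η θ * S.joint θ z * S.q θ θ'

theorem measurable_moveDensity :
    Measurable fun p : (Θ × Θ) × Path Z n => S.moveDensity p.1.1 p.1.2 p.2 :=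
  ((S.measurable_η.comp (f := fun p : (Θ × Θ) × Path Z n => p.1.1) (by fun_prop)).mul
    (S.measurable_joint.comp (f := fun p : (Θ × Θ) × Path Z n => (p.1.1, p.2))
      (by fun_prop))).mul
    (S.measurable_q.comp (f := fun p : (Θ × Θ) × Path Z n => p.1) measurable_fst)

/-- Puts the ratio in the form `y_i / x`, where `x` depends only on `z` and `y_i` only on `u^{(i)}`,
as `mul_choice_mul_min` requires. -/
theorem ratio_eq_div_div {θ θ' m : Θ} {z u : Path Z n} (hz : S.joint m z ≠ 0)
    (hu : S.joint m u ≠ 0) :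
    S.ratio θ θ' m z u = S.moveDensity θ' θ u / S.joint m u /
      (S.moveDensity θ θ' z / S.joint m z) := by
  rw [div_div_div_eq (by simpa using hu) ENNReal.coe_ne_top (by simpa using hz)
    ENNReal.coe_ne_top, ratio, moveDensity, moveDensity]
  push_cast
  congr 1 <;> ring

theorem accept₁_eq_zero {N : ℕ} {θ θ' : Θ} {z : Path Z n} (hz : S.joint (S.mid₁ θ θ') z = 0)
    (u : Fin N → Path Z n) : S.accept₁ θ θ' z u = 0 := by
  simp [accept₁, avgRatio, ratio, hz]

section

variable [SigmaFinite lam] (N M : ℕ) [NeZero M]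

/-- For fixed parameters, the accepted moves of the first branch are the reversals of the accepted
moves of the second branch. -/
theorem lintegral_accept₁_eq_lintegral_accept₂ (θ θ' : Θ) {Ga Gb : Path Z n → ℝ≥0∞}
    (hGa : Measurable Ga) (hGb : Measurable Gb) :
    ∫⁻ z, S.moveDensity θ θ' z * ∫⁻ u, Ga z * ∑ k,
        choice (fun i => S.ratio θ θ' (S.mid₁ θ θ') z (u i)) k * (S.accept₁ θ θ' z u * Gb (u k))
        ∂(S.cSMCPaths N M (S.mid₁ θ θ', z)) ∂(Measure.pi fun _ => lam) =
      ∫⁻ z, S.moveDensity θ' θ z * ∫⁻ u, Gb z * ∑ k, (N : ℝ≥0∞)⁻¹ *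
        (S.accept₂ θ' θ z (u k) (Function.update u k z) * Ga (u k))
        ∂(S.cSMCPaths N M (S.mid₂ θ' θ, z)) ∂(Measure.pi fun _ => lam) := by
  have hmid : S.mid₂ θ' θ = S.mid₁ θ θ' := (S.mid_symm θ θ').symm
  set m := S.mid₁ θ θ' with hm
  rw [hmid]
  have hd (θ θ' : Θ) : Measurable fun z => S.moveDensity θ θ' z :=
    S.measurable_moveDensity.comp (f := fun z => ((θ, θ'), z)) measurable_prodMk_left
  let c (θ θ' : Θ) (p : Path Z n × (Fin N → Path Z n)) :
      (Θ × Path Z n) × (Θ × (Fin N → Path Z n)) := ((θ, p.1), (θ', p.2))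
  have hc (θ θ' : Θ) : Measurable (c θ θ') := by fun_prop
  have hsel (k : Fin N) : Measurable fun p : Path Z n × (Fin N → Path Z n) =>
      choice (fun i => S.ratio θ θ' m p.1 (p.2 i)) k :=
    (S.measurable_choice_ratio k).comp (f := c θ θ') (hc θ θ')
  have hacc₁ : Measurable fun p : Path Z n × (Fin N → Path Z n) => S.accept₁ θ θ' p.1 p.2 :=
    S.measurable_accept₁.comp (f := c θ θ') (hc θ θ')
  have hacc₂ (k : Fin N) : Measurable fun p : Path Z n × (Fin N → Path Z n) =>
      S.accept₂ θ' θ p.1 (p.2 k) (Function.update p.2 k p.1) :=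
    (S.measurable_accept₂ k).comp (f := c θ' θ) (hc θ' θ)
  have hF₁ : Measurable fun p : Path Z n × (Fin N → Path Z n) => Ga p.1 * ∑ k,
      choice (fun i => S.ratio θ θ' m p.1 (p.2 i)) k * (S.accept₁ θ θ' p.1 p.2 * Gb (p.2 k)) :=
    (hGa.comp measurable_fst).mul (Finset.measurable_sum _ fun k _ => (hsel k).mul
      (hacc₁.mul (hGb.comp (f := fun p : Path Z n × (Fin N → Path Z n) => p.2 k) (by fun_prop))))
  have hF₂ : Measurable fun p : Path Z n × (Fin N → Path Z n) => Gb p.1 * ∑ k, (N : ℝ≥0∞)⁻¹ *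
      (S.accept₂ θ' θ p.1 (p.2 k) (Function.update p.2 k p.1) * Ga (p.2 k)) :=
    (hGb.comp measurable_fst).mul (Finset.measurable_sum _ fun k _ =>
      ((hacc₂ k).mul (hGa.comp
        (f := fun p : Path Z n × (Fin N → Path Z n) => p.2 k) (by fun_prop))).const_mul _)
  -- The branch-2 flow through index `k`, relative to the joint law. Evaluated at the swapped
  -- configuration, it matches the branch-1 flow pointwise almost everywhere.
  let R (k : Fin N) (p : Path Z n × (Fin N → Path Z n)) : ℝ≥0∞ :=
    (S.moveDensity θ' θ p.1 : ℝ≥0∞) / S.joint m p.1 * (Gb p.1 * ((N : ℝ≥0∞)⁻¹ *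
      (S.accept₂ θ' θ p.1 (p.2 k) (Function.update p.2 k p.1) * Ga (p.2 k))))
  have hR (k : Fin N) : Measurable (R k) :=
    (((hd θ' θ).comp measurable_fst).coe_nnreal_ennreal.div
      ((S.measurable_joint_right m).comp measurable_fst).coe_nnreal_ennreal).mul
      ((hGb.comp measurable_fst).mul
        (((hacc₂ k).mul (hGa.comp
        (f := fun p : Path Z n × (Fin N → Path Z n) => p.2 k) (by fun_prop))).const_mul _))
  have hR' (k : Fin N) : Measurable fun p : Path Z n × (Fin N → Path Z n) =>
      R k (p.2 k, Function.update p.2 k p.1) :=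
    (hR k).comp ((by fun_prop : Measurable fun p : Path Z n × (Fin N → Path Z n) =>
      p.2 k).prodMk (measurable_update'.comp (measurable_snd.prodMk measurable_fst)))
  rw [S.lintegral_eq_lintegral_jointLaw N M m (hd θ θ') hF₁ fun z u hz => by
      simp [S.accept₁_eq_zero hz],
    S.lintegral_eq_lintegral_jointLaw N M m (hd θ' θ) hF₂ fun z u hz => by
      simp [accept₂, hmid, hz]]
  calc _ = ∫⁻ p, ∑ k, R k (p.2 k, Function.update p.2 k p.1) ∂(S.jointLaw N M m) := by
        refine lintegral_congr_ae ((S.ae_jointLaw_joint_ne_zero N M m).mono fun p ⟨hz, hu⟩ => ?_)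
        obtain ⟨z, u⟩ := p
        dsimp only [R] at hz hu ⊢
        rw [← mul_assoc, Finset.mul_sum]
        refine Finset.sum_congr rfl fun k _ => ?_
        have hdiv (θ θ' : Θ) {z : Path Z n} (hz : S.joint m z ≠ 0) :
            (S.moveDensity θ θ' z : ℝ≥0∞) / S.joint m z ≠ ∞ :=
          ENNReal.div_ne_top ENNReal.coe_ne_top (by simpa using hz)
        have key := mul_choice_mul_min (hdiv θ θ' hz) (fun i => hdiv θ' θ (hu i)) k
        simp only [← S.ratio_eq_div_div hz (hu _)] at key
        -- Inserting the reference after the swap restores the original `u`, so both branches use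
        -- the same averaged ratio.
        simp only [Function.update_self, Function.update_idem, Function.update_eq_self]
        rw [accept₁, accept₂, hmid, if_neg (hu k), avgRatio, ← hm]
        calc _ = (S.moveDensity θ θ' z : ℝ≥0∞) / S.joint m z *
              (choice (fun i => S.ratio θ θ' m z (u i)) k *
                min 1 ((N : ℝ≥0∞)⁻¹ * ∑ i, S.ratio θ θ' m z (u i))) * (Ga z * Gb (u k)) := by ring
          _ = _ := by rw [key]; ring
    _ = ∑ k, ∫⁻ p, R k p ∂(S.jointLaw N M m) := by
        rw [lintegral_finsetSum _ fun k _ => hR' k]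
        exact Finset.sum_congr rfl fun k _ => S.lintegral_jointLaw_swap N M m (hR k) k
    _ = _ := by
        rw [← lintegral_finsetSum _ fun k _ => hR k]
        refine lintegral_congr fun p => ?_
        simp only [R, Finset.mul_sum]

end

/-! ### Integration over the parameters and detailed balance. -/

theorem measurable_lintegral_cSMCPaths [SigmaFinite lam] (N M : ℕ) [NeZero M]
    (mid : Θ → Θ → Θ) (hmid : Measurable fun p : Θ × Θ => mid p.1 p.2)
    {F : (Θ × Path Z n) × (Θ × (Fin N → Path Z n)) → ℝ≥0∞} (hF : Measurable F) :
    Measurable fun p : (Θ × Path Z n) × Θ =>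
      ∫⁻ u, F (p.1, (p.2, u)) ∂(S.cSMCPaths N M (mid p.1.1 p.2, p.1.2)) := by
  have hg : Measurable fun p : (Θ × Path Z n) × Θ => (mid p.1.1 p.2, p.1.2) :=
    (hmid.comp (f := fun p : (Θ × Path Z n) × Θ => (p.1.1, p.2)) (by fun_prop)).prodMk
      (by fun_prop)
  have hF' : Measurable fun p : ((Θ × Path Z n) × Θ) × (Fin N → Path Z n) =>
      F (p.1.1, (p.1.2, p.2)) :=
    hF.comp (f := fun p : ((Θ × Path Z n) × Θ) × (Fin N → Path Z n) =>
      (p.1.1, (p.1.2, p.2))) (by fun_prop)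
  exact hF'.lintegral_kernel_prod_right' (κ := (S.cSMCPaths N M).comap _ hg)

theorem lintegral_draw [SigmaFinite σ] [SigmaFinite lam] (N M : ℕ) [NeZero M]
    (mid : Θ → Θ → Θ) (hmid : Measurable fun p : Θ × Θ => mid p.1 p.2)
    {F : (Θ × Path Z n) × (Θ × (Fin N → Path Z n)) → ℝ≥0∞} (hF : Measurable F)
    (x : Θ × Path Z n) :
    ∫⁻ p, F (x, p) ∂(S.draw N M mid hmid x) = ∫⁻ θ', S.q x.1 θ' *
      ∫⁻ u, F (x, (θ', u)) ∂(S.cSMCPaths N M (mid x.1 θ', x.2)) ∂σ := by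
  have hm := S.measurable_lintegral_cSMCPaths N M mid hmid hF
  have hq : Measurable (Function.uncurry fun θ θ' => (S.q θ θ' : ℝ≥0∞)) :=
    S.measurable_q.coe_nnreal_ennreal
  rw [draw, Kernel.lintegral_compProd _ _ _ (f := fun p => F (x, p))
    (hF.comp measurable_prodMk_left)]
  exact Kernel.lintegral_withDensity _ hq _ (hm.comp (measurable_prodMk_left (x := x)))

theorem measurable_lintegral_moveDensity [SigmaFinite lam] (N M : ℕ) [NeZero M]
    (mid : Θ → Θ → Θ) (hmid : Measurable fun p : Θ × Θ => mid p.1 p.2)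
    {F : (Θ × Path Z n) × (Θ × (Fin N → Path Z n)) → ℝ≥0∞} (hF : Measurable F) :
    Measurable fun p : Θ × Θ =>
      ∫⁻ z, S.moveDensity p.1 p.2 z * ∫⁻ u, F ((p.1, z), (p.2, u))
      ∂(S.cSMCPaths N M (mid p.1 p.2, z)) ∂(Measure.pi fun _ => lam) := by
  have hm := (S.measurable_lintegral_cSMCPaths N M mid hmid hF).comp
    (f := fun p : (Θ × Θ) × Path Z n => ((p.1.1, p.2), p.1.2)) (by fun_prop)
  exact (S.measurable_moveDensity.coe_nnreal_ennreal.mul hm).lintegral_prod_right'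

/-- Tonelli moves the integral over `z` inside those over the two parameters, so that each pair `(θ,
θ')` can be treated separately. -/
theorem lintegral_posterior_draw [SigmaFinite σ] [SigmaFinite lam] (N M : ℕ) [NeZero M]
    (mid : Θ → Θ → Θ) (hmid : Measurable fun p : Θ × Θ => mid p.1 p.2)
    {F : (Θ × Path Z n) × (Θ × (Fin N → Path Z n)) → ℝ≥0∞} (hF : Measurable F) :
    ∫⁻ x, ∫⁻ p, F (x, p) ∂(S.draw N M mid hmid x) ∂S.posterior =
      S.evidence⁻¹ * ∫⁻ θ, ∫⁻ θ', ∫⁻ z, S.moveDensity θ θ' z * ∫⁻ u, F ((θ, z), (θ', u))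
        ∂(S.cSMCPaths N M (mid θ θ', z)) ∂(Measure.pi fun _ => lam) ∂σ ∂σ := by
  have hm := S.measurable_lintegral_cSMCPaths N M mid hmid hF
  have hd : Measurable fun x => ∫⁻ p, F (x, p) ∂(S.draw N M mid hmid x) :=
    hF.lintegral_kernel_prod_right'
  have hη : Measurable fun x : Θ × Path Z n => (S.η x.1 * S.joint x.1 x.2 : ℝ≥0∞) :=
    (S.measurable_η.comp measurable_fst).coe_nnreal_ennreal.mul
      S.measurable_joint.coe_nnreal_ennreal
  rw [posterior, lintegral_smul_measure, smul_eq_mul,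
    lintegral_withDensity_eq_lintegral_mul _ hη hd, lintegral_prod _ (hη.mul hd).aemeasurable]
  congr 1
  refine lintegral_congr fun θ => ?_
  have hg : Measurable fun p : Path Z n × Θ => (S.moveDensity θ p.2 p.1 : ℝ≥0∞) *
      ∫⁻ u, F ((θ, p.1), (p.2, u)) ∂(S.cSMCPaths N M (mid θ p.2, p.1)) :=
    (S.measurable_moveDensity.comp (f := fun p : Path Z n × Θ => ((θ, p.2), p.1))
      (by fun_prop)).coe_nnreal_ennreal.mul
      (hm.comp (f := fun p : Path Z n × Θ => ((θ, p.1), p.2)) (by fun_prop))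
  rw [← lintegral_lintegral_swap hg.aemeasurable]
  refine lintegral_congr fun z => ?_
  rw [Pi.mul_apply, S.lintegral_draw N M mid hmid hF, ← lintegral_const_mul']
  · refine lintegral_congr fun θ' => ?_
    rw [moveDensity]
    push_cast
    simp only [mul_assoc]
  · exact ENNReal.mul_ne_top ENNReal.coe_ne_top ENNReal.coe_ne_top

/-- The probability of a move into `B` in the first branch, given the proposals. -/
def moveProb₁ {N : ℕ} (B : Set (Θ × Path Z n)) (p : (Θ × Path Z n) × (Θ × (Fin N → Path Z n))) :
    ℝ≥0∞ :=
  ∑ k, choice (fun i => S.ratio p.1.1 p.2.1 (S.mid₁ p.1.1 p.2.1) p.1.2 (p.2.2 i)) k *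
    (S.accept₁ p.1.1 p.2.1 p.1.2 p.2.2 * B.indicator 1 (p.2.1, p.2.2 k))

/-- The probability of a move into `B` in the second branch, given the proposals. -/
def moveProb₂ {N : ℕ} (B : Set (Θ × Path Z n)) (p : (Θ × Path Z n) × (Θ × (Fin N → Path Z n))) :
    ℝ≥0∞ :=
  ∑ k, (N : ℝ≥0∞)⁻¹ * (S.accept₂ p.1.1 p.2.1 p.1.2 (p.2.2 k) (Function.update p.2.2 k p.1.2) *
    B.indicator 1 (p.2.1, p.2.2 k))

theorem measurable_indicator_proposal {N : ℕ} {B : Set (Θ × Path Z n)} (hB : MeasurableSet B)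
    (k : Fin N) : Measurable fun p : (Θ × Path Z n) × (Θ × (Fin N → Path Z n)) =>
      B.indicator (1 : Θ × Path Z n → ℝ≥0∞) (p.2.1, p.2.2 k) :=
  (measurable_one.indicator hB).comp
    (f := fun p : (Θ × Path Z n) × (Θ × (Fin N → Path Z n)) => (p.2.1, p.2.2 k)) (by fun_prop)

theorem measurable_moveProb₁ {N : ℕ} {B : Set (Θ × Path Z n)} (hB : MeasurableSet B) :
    Measurable (S.moveProb₁ (N := N) B) :=
  Finset.measurable_sum _ fun k _ => (S.measurable_choice_ratio k).mul
    (S.measurable_accept₁.mul (measurable_indicator_proposal hB k))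

theorem measurable_moveProb₂ {N : ℕ} {B : Set (Θ × Path Z n)} (hB : MeasurableSet B) :
    Measurable (S.moveProb₂ (N := N) B) :=
  Finset.measurable_sum _ fun k _ =>
    ((S.measurable_accept₂ k).mul (measurable_indicator_proposal hB k)).const_mul _

/-- In stationarity, the accepted moves of the first branch are the reversals of the accepted moves
of the second branch. -/
theorem setLIntegral_moveProb₁_eq [SigmaFinite σ] [SigmaFinite lam] (N M : ℕ) [NeZero M]
    {A B : Set (Θ × Path Z n)} (hA : MeasurableSet A) (hB : MeasurableSet B) :
    ∫⁻ x in A, ∫⁻ p, S.moveProb₁ B (x, p) ∂(S.draw N M S.mid₁ S.measurable_mid₁ x) ∂S.posterior =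
      ∫⁻ x in B, ∫⁻ p, S.moveProb₂ A (x, p) ∂(S.draw N M S.mid₂ S.measurable_mid₂ x)
        ∂S.posterior := by
  have hi {A : Set (Θ × Path Z n)} (hA : MeasurableSet A) :
      Measurable (A.indicator (1 : Θ × Path Z n → ℝ≥0∞)) := measurable_one.indicator hA
  have hiθ {A : Set (Θ × Path Z n)} (hA : MeasurableSet A) (θ : Θ) :
      Measurable fun z => A.indicator (1 : Θ × Path Z n → ℝ≥0∞) (θ, z) :=
    (hi hA).comp (f := fun z => (θ, z)) measurable_prodMk_left
  have hset {A : Set (Θ × Path Z n)} (hA : MeasurableSet A)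
      (F : (Θ × Path Z n) × (Θ × (Fin N → Path Z n)) → ℝ≥0∞)
      (κ : Kernel (Θ × Path Z n) (Θ × (Fin N → Path Z n))) :
      ∫⁻ x in A, ∫⁻ p, F (x, p) ∂(κ x) ∂S.posterior =
        ∫⁻ x, ∫⁻ p, A.indicator 1 x * F (x, p) ∂(κ x) ∂S.posterior := by
    rw [← lintegral_indicator hA]
    refine lintegral_congr fun x => ?_
    by_cases hx : x ∈ A <;> simp [hx]
  have h₁ : Measurable fun p : (Θ × Path Z n) × (Θ × (Fin N → Path Z n)) =>
      A.indicator 1 p.1 * S.moveProb₁ B p :=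
    ((hi hA).comp measurable_fst).mul (S.measurable_moveProb₁ hB)
  have h₂ : Measurable fun p : (Θ × Path Z n) × (Θ × (Fin N → Path Z n)) =>
      B.indicator 1 p.1 * S.moveProb₂ A p :=
    ((hi hB).comp measurable_fst).mul (S.measurable_moveProb₂ hA)
  -- Branch 2 has the two parameters in reversed roles, so exchanging their integrals reduces the
  -- claim to the balance for each fixed pair.
  have hswap := lintegral_lintegral_swap (μ := σ) (ν := σ)
    (f := fun θ θ' => ∫⁻ z, S.moveDensity θ θ' z * ∫⁻ u, B.indicator 1 (θ, z) *
      S.moveProb₂ A ((θ, z), (θ', u)) ∂(S.cSMCPaths N M (S.mid₂ θ θ', z))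
      ∂(Measure.pi fun _ => lam))
    (S.measurable_lintegral_moveDensity N M S.mid₂ S.measurable_mid₂ h₂).aemeasurable
  rw [hset hA, hset hB, S.lintegral_posterior_draw N M S.mid₁ S.measurable_mid₁ h₁,
    S.lintegral_posterior_draw N M S.mid₂ S.measurable_mid₂ h₂, hswap]
  congr 1
  refine lintegral_congr fun θ => lintegral_congr fun θ' => ?_
  exact S.lintegral_accept₁_eq_lintegral_accept₂ N M θ θ' (hiθ hA θ) (hiθ hB θ')

theorem isReversible_transition [SigmaFinite σ] [SigmaFinite lam] (N M : ℕ) [NeZero M] :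
    (S.transition N M).IsReversible S.posterior :=
  isReversible_halfMix
    (a₁ := fun B x => ∫⁻ p, S.moveProb₁ B (x, p) ∂(S.draw N M S.mid₁ S.measurable_mid₁ x))
    (a₂ := fun B x => ∫⁻ p, S.moveProb₂ B (x, p) ∂(S.draw N M S.mid₂ S.measurable_mid₂ x))
    (fun _ hB => (S.measurable_moveProb₁ hB).lintegral_kernel_prod_right')
    (fun _ hB => (S.measurable_moveProb₂ hB).lintegral_kernel_prod_right')
    (fun x B hB => discreteKernel_comp_id_prod_apply (S.draw N M S.mid₁ S.measurable_mid₁)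
      (fun k => S.measurable_choice_ratio k) (fun _ => S.measurable_accept₁)
      (F := fun k p => (p.2.1, p.2.2 k)) (fun k => by fun_prop) _ _ x hB)
    (fun x B hB => discreteKernel_comp_id_prod_apply (S.draw N M S.mid₂ S.measurable_mid₂)
      (c := fun _ _ => (N : ℝ≥0∞)⁻¹) (fun _ => measurable_const)
      (fun k => S.measurable_accept₂ k)
      (F := fun k p => (p.2.1, p.2.2 k)) (fun k => by fun_prop) _ _ x hB)
    fun _ _ hA hB => S.setLIntegral_moveProb₁_eq N M hA hB

end Setting

end MHAAR

end

theorem mainTheorem11 {Θ Z Y : Type*} [MeasurableSpace Θ] [MeasurableSpace Z]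
    (σ : Measure Θ) [SigmaFinite σ] (lam : Measure Z) [SigmaFinite lam] (n : ℕ)
    (S : MHAAR.Setting Θ Z Y σ lam n) (hpos : S.evidence ≠ 0) (hfin : S.evidence ≠ ∞)
    (M N : ℕ) [NeZero M] [NeZero N] :
    IsProbabilityMeasure S.posterior ∧ IsMarkovKernel (S.transition N M) ∧
      (S.transition N M).IsReversible S.posterior :=
  ⟨S.isProbabilityMeasure_posterior hpos hfin, inferInstance, S.isReversible_transition N M⟩
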